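/- Let $q$ be a prime power, let $\mathbb{F}_q$ be the field with $q$ elements, and put $e=1$ if $q$ is even and $e=2$ if $q$ is odd. For a polynomial $f\in\mathbb{F}_q[t]$ of degree $n$ with constant term $a_0\neq 0$ let $f^*(t)=a_0^{-1}t^{n}f(t^{-1})$. Let $N^*(q;d)$ be the number of monic irreducible $f\in\mathbb{F}_q[t]$ of degree $d$ with nonzero constant term and $f=f^*$, and let $M^*(q;d)$ be the number of unordered pairs $\{g,g^*\}$ with $g\in\mathbb{F}_q[t]$ monic irreducible of degree $d$ with nonzero constant term and $g\neq g^*$. Let $\mathcal{P}$ be the set of all partitions of nonnegative integers, including the empty partition. For $\lambda=(\lambda_1\ge\dots\ge\lambda_l>0)\in\mathcal{P}$ put $|\lambda|=\sum_i\lambda_i$ and $a(\lambda)=\sum_{i=1}^{l}(i-1)\lambda_i$, and let $s_\lambda(x_1,x_2,\ldots)$ be the Schur function of $\lambda$ in countably many variables. Define $$\delta_{\mathrm U}(\lambda,d)=\frac{(-1)^{a(\lambda)}}{q^{d|\lambda|/2}}\,s_\lambda\!\left(1,-\tfrac1{q^{d/2}},\left(-\tfrac1{q^{d/2}}\right)^2,\ldots\right),\qquad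 \delta_{\mathrm{GL}}(\lambda,d)=\frac1{q^{d|\lambda|}}\,s_\lambda\!\left(1,\tfrac1{q^{d}},\tfrac1{q^{2d}},\ldots\right).$$ Then the following identity of power series in the indeterminate $u$ with real coefficients holds, where infinite sums and products are taken coefficientwise and all of them, including the series that define the values of $s_\lambda$ for $\delta_{\mathrm U}(\lambda,2d)$ and $\delta_{\mathrm{GL}}(\lambda,d)$, $d\ge1$, converge unconditionally: $$\prod_{d\ge1}\Bigl(\sum_{\lambda\in\mathcal P}\delta_{\mathrm U}(\lambda,2d)\,u^{|\lambda|d}\Bigr)^{N^*(q;2d)}\ \prod_{d\ge1}\Bigl(\sum_{\lambda\in\mathcal P}\delta_{\mathrm{GL}}(\lambda,d)\,u^{|\lambda|d}\Bigr)^{M^*(q;d)}=\frac1{1-u}\prod_{i\ge1}\frac{(1-u/q^{2i-1})^e}{1-u^2/q^{2i}}\prod_{\substack{1\le i<j\\ i+j\ \mathrm{odd}}}\bigl(1-u^2/q^{i+j}\bigr)^e .$$ -/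

import Mathlib

/- Power series over `ℝ` carry the topology of coefficientwise convergence (in the usual topology
of `ℝ`); infinite sums and products of power series are taken in it. -/
open scoped PowerSeries.WithPiTopology

noncomputable section

namespace CharDegree

open Polynomial in
/-- The dual `f^*(t) = a₀⁻¹ t^(deg f) f(t⁻¹)` of a polynomial `f` with constant term `a₀ ≠ 0`. -/
def dualPoly {F : Type*} [Field F] (f : F[X]) : F[X] :=
  C (f.coeff 0)⁻¹ * f.reverse

open Polynomial in
/-- The monic irreducible polynomials over `F` with nonzero constant term. -/
def monicIrred (F : Type*) [Field F] : Set F[X] :=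
  {f | f.Monic ∧ Irreducible f ∧ f.coeff 0 ≠ 0}

open Polynomial in
/-- `N^*(q; d)` for `F = 𝔽_q`: the number of self-dual monic irreducible polynomials over `F` of
degree `d` with nonzero constant term. -/
def numSelfDual (F : Type*) [Field F] (d : ℕ) : ℕ :=
  Set.ncard {f : F[X] | f ∈ monicIrred F ∧ f = dualPoly f ∧ f.natDegree = d}

open Polynomial in
/-- `M^*(q; d)` for `F = 𝔽_q`: the number of unordered pairs `{g, g^*}` with `g ≠ g^*`, where `g`
is monic irreducible over `F` of degree `d` with nonzero constant term. -/
def numDualPairs (F : Type*) [Field F] (d : ℕ) : ℕ :=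
  Set.ncard {p : Sym2 F[X] |
    ∃ g : F[X], g ∈ monicIrred F ∧ g ≠ dualPoly g ∧ g.natDegree = d ∧ p = s(g, dualPoly g)}

/-- The statistic `a(μ) = ∑_{i=1}^{l} (i - 1) μ_i` of a partition `μ = (μ_1, …, μ_l)`, given by its
Young diagram (whose rows are indexed from `0`). -/
def aStat (μ : YoungDiagram) : ℕ :=
  ∑ i ∈ Finset.range (μ.colLen 0), i * μ.rowLen i

/-- The monomial `x^T` of a semistandard tableau `T` at real values of the variables; the entry `k`
stands for the variable `x k` (so `x 0, x 1, …` are the first, second, … variables). -/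
def tableauTerm (μ : YoungDiagram) (x : ℕ → ℝ) (T : SemistandardYoungTableau μ) : ℝ :=
  ∏ c ∈ μ.cells, x (T c.1 c.2)

/-- The Schur function `s_μ = ∑_T x^T` (sum over the semistandard tableaux of shape `μ`) at real
values `x 0, x 1, …` of its countably many variables. -/
def schur (μ : YoungDiagram) (x : ℕ → ℝ) : ℝ :=
  ∑' T : SemistandardYoungTableau μ, tableauTerm μ x T

/-- The variables `1, -1/q^(d/2), (-1/q^(d/2))^2, …`. -/
def varsU (q d : ℕ) (k : ℕ) : ℝ := (-1 / (q : ℝ) ^ ((d : ℝ) / 2)) ^ k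

/-- The variables `1, 1/q^d, 1/q^(2d), …`. -/
def varsGL (q d : ℕ) (k : ℕ) : ℝ := 1 / (q : ℝ) ^ (k * d)

/-- `δ_U(μ, d) = q^(-d|μ|/2) (-1)^(a(μ)) s_μ(1, -1/q^(d/2), (-1/q^(d/2))^2, …)`. -/
def deltaU (q : ℕ) (μ : YoungDiagram) (d : ℕ) : ℝ :=
  1 / (q : ℝ) ^ ((d : ℝ) * (μ.card : ℝ) / 2) * (-1) ^ aStat μ * schur μ (varsU q d)

/-- `δ_GL(μ, d) = q^(-d|μ|) s_μ(1, 1/q^d, 1/q^(2d), …)`. -/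
def deltaGL (q : ℕ) (μ : YoungDiagram) (d : ℕ) : ℝ :=
  1 / (q : ℝ) ^ (d * μ.card) * schur μ (varsGL q d)

/-- `e = 1` if `q` is even and `e = 2` if `q` is odd. -/
def eNum (q : ℕ) : ℕ := if Even q then 1 else 2

open PowerSeries in
/-- The summand `δ_U(μ, 2d) u^(|μ| d)`, where `u` is the indeterminate. -/
def termU (q d : ℕ) (μ : YoungDiagram) : ℝ⟦X⟧ :=
  C (deltaU q μ (2 * d)) * X ^ (μ.card * d)

open PowerSeries in
/-- The summand `δ_GL(μ, d) u^(|μ| d)`. -/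
def termGL (q d : ℕ) (μ : YoungDiagram) : ℝ⟦X⟧ :=
  C (deltaGL q μ d) * X ^ (μ.card * d)

open PowerSeries in
/-- The factor `(∑_μ δ_U(μ, 2d) u^(|μ| d))^(N^*(q; 2d))`, with `F = 𝔽_q`. -/
def factorU (F : Type*) [Field F] (q : ℕ) (d : ℕ+) : ℝ⟦X⟧ :=
  (∑' μ : YoungDiagram, termU q d μ) ^ numSelfDual F (2 * d)

open PowerSeries in
/-- The factor `(∑_μ δ_GL(μ, d) u^(|μ| d))^(M^*(q; d))`, with `F = 𝔽_q`. -/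
def factorGL (F : Type*) [Field F] (q : ℕ) (d : ℕ+) : ℝ⟦X⟧ :=
  (∑' μ : YoungDiagram, termGL q d μ) ^ numDualPairs F d

open PowerSeries in
/-- The factor `(1 - u/q^(2i-1))^e / (1 - u^2/q^(2i))`. -/
def factorSingle (q : ℕ) (i : ℕ+) : ℝ⟦X⟧ :=
  (1 - C (1 / (q : ℝ) ^ (2 * (i : ℕ) - 1)) * X) ^ eNum q *
    (1 - C (1 / (q : ℝ) ^ (2 * (i : ℕ))) * X ^ 2)⁻¹

/-- The pairs `1 ≤ i < j` with `i + j` odd. -/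
abbrev OddPair : Type := {p : ℕ+ × ℕ+ // p.1 < p.2 ∧ Odd ((p.1 : ℕ) + (p.2 : ℕ))}

open PowerSeries in
/-- The factor `(1 - u^2/q^(i+j))^e`. -/
def factorPair (q : ℕ) (p : OddPair) : ℝ⟦X⟧ :=
  (1 - C (1 / (q : ℝ) ^ ((p.1.1 : ℕ) + (p.1.2 : ℕ))) * X ^ 2) ^ eNum q

end CharDegree

end

/-! ### Young diagrams, horizontal strips and the local growth rule. -/

noncomputable section

namespace YoungDiagram

/-! For `ε = ±1`, Littlewood's identity with sign reads `∑_μ ε^(a(μ)) s_μ(x) = ∏_i (1 - x_i)⁻¹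
∏_{i<j} (1 - ε x_i x_j)⁻¹`. By homogeneity of `s_μ`, the sums on the left of the theorem are its
left side at `x_i = ε^i (u/q^(i+1))^d`, with `ε = -1` for the unitary factors and `ε = 1` for the
linear ones. At these values every factor of the product is `1 - τ v^d`, where `v` is `u/q^(i+1)` or
`u^2/q^(2i+k+3)` (for `j = i+k+1`), and `τ` is `ε^i` or `ε^k`. Neither `v` nor the exponent of `ε`
depends on `d`.

Exchanging the product over `d` with the product over the factors therefore turns the inverse of the
left side into a product of the series `E_τ(v) = ∏_d (1 - τ v^d)^(N^*(q;2d)) (1 - v^d)^(M^*(q;d))`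
with `τ = ±1`. Counting the irreducible factors of `X^(q^k+1) - 1` and of `X^(q^k) - X` determines
the logarithmic derivatives and gives `E_1(v) (1-v)^e = 1 - qv` and `E_{-1}(v) (1-v) = 1`. Since `1
- qv` at `v/q^(n+1)` is `1 - v/q^n`, the products of alternating `E_1` and `E_{-1}` telescope: the
linear factors leave `1 - u`, the `i`-th row of quadratic factors leaves `1 - u^2/q^(2i+2)`, and the
powers `(1-v)^e` are the numerators on the right.

The main lemmas are `tsum_sign_mul_schurSeries_mul_prod` (Littlewood, from the bijection `growth`),
`eulerProd_one_mul` and `eulerProd_neg_one_mul` (counting), `tprod_dilate_eulerProd_mul`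
(telescoping) and `tprod_factorU_mul_tprod_factorGL_mul` (exchange of products). -/

theorem ext_rowLen {μ ν : YoungDiagram} (h : ∀ i, μ.rowLen i = ν.rowLen i) : μ = ν := by
  ext ⟨i, j⟩
  rw [mem_cells, mem_cells, mem_iff_lt_rowLen, mem_iff_lt_rowLen, h]

/-- The Young diagram whose `i`-th row has length `f i`. -/
def ofRows (f : ℕ → ℕ) (hf : Antitone f) (N : ℕ) (_hN : f N = 0) : YoungDiagram where
  cells := (Finset.range N ×ˢ Finset.range (f 0)).filter fun c => c.2 < f c.1
  isLowerSet := by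
    rintro ⟨i, j⟩ ⟨i', j'⟩ ⟨hi, hj⟩ h
    simp only [Finset.coe_filter, Finset.mem_product, Finset.mem_range, Set.mem_ofPred_eq] at h ⊢
    simp only at hi hj
    have h1 := hf hi
    have h2 := hf (Nat.zero_le i')
    omega

theorem rowLen_ofRows (f : ℕ → ℕ) (hf : Antitone f) (N : ℕ) (hN : f N = 0) (i : ℕ) :
    (ofRows f hf N hN).rowLen i = f i := by
  have key : ∀ j, j < (ofRows f hf N hN).rowLen i ↔ j < f i := by
    intro j
    rw [← mem_iff_lt_rowLen, ← mem_cells]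
    simp only [ofRows, Finset.mem_filter, Finset.mem_product, Finset.mem_range,
      and_iff_right_iff_imp]
    intro h
    have h2 := hf (Nat.zero_le i)
    refine ⟨?_, by omega⟩
    by_contra hc
    have := hf (not_lt.1 hc)
    omega
  exact le_antisymm (le_of_forall_lt fun j h => (key j).1 h)
    (le_of_forall_lt fun j h => (key j).2 h)

theorem rowLen_eq_zero_iff {μ : YoungDiagram} {i : ℕ} : μ.rowLen i = 0 ↔ μ.colLen 0 ≤ i := by
  rw [← not_lt, ← mem_iff_lt_colLen, mem_iff_lt_rowLen]
  omega

theorem sum_rowLen_eq {μ : YoungDiagram} {N : ℕ} (hN : μ.rowLen N = 0) :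
    ∑ i ∈ Finset.range N, μ.rowLen i = μ.card := by
  have h : ∀ c ∈ μ.cells, c.1 ∈ Finset.range N := by
    rintro ⟨i, j⟩ hc
    rw [mem_cells, mem_iff_lt_rowLen] at hc
    rw [Finset.mem_range]
    by_contra hcon
    have := μ.rowLen_anti N i (not_lt.1 hcon)
    omega
  rw [YoungDiagram.card, Finset.card_eq_sum_card_fiberwise h]
  refine Finset.sum_congr rfl fun i _ => ?_
  rw [rowLen_eq_card]
  rfl

theorem sum_mul_rowLen_eq {μ : YoungDiagram} {N : ℕ} (hN : μ.rowLen N = 0) :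
    ∑ i ∈ Finset.range N, i * μ.rowLen i = CharDegree.aStat μ := by
  rw [CharDegree.aStat]
  refine (Finset.sum_subset (Finset.range_mono (rowLen_eq_zero_iff.1 hN)) fun i _ hi => ?_).symm
  rw [rowLen_eq_zero_iff.2 (by simpa using hi), mul_zero]

theorem card_mono {μ ν : YoungDiagram} (h : μ ≤ ν) : μ.card ≤ ν.card :=
  Finset.card_le_card (cells_subset_iff.2 h)

/-- A cell `(i, j)` forces `i + 1` cells in its column and `j + 1` in its row, so a diagram with at
most `m` cells fits into an `m × m` box. -/
theorem finite_setOf_card_le (m : ℕ) : {μ : YoungDiagram | μ.card ≤ m}.Finite := by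
  refine Set.Finite.of_finite_image (f := YoungDiagram.cells)
    ((Finset.finite_toSet (Finset.range m ×ˢ Finset.range m).powerset).subset ?_) ?_
  · rintro _ ⟨μ, hμ, rfl⟩
    simp only [Finset.coe_powerset, Set.mem_preimage, Set.mem_powerset_iff]
    rintro ⟨i, j⟩ hc
    have hc' : (i, j) ∈ μ := hc
    have h1 : Finset.range (i + 1) ×ˢ {j} ⊆ μ.cells := by
      rintro ⟨a, b⟩ hab
      simp only [Finset.mem_product, Finset.mem_range, Finset.mem_singleton] at hab
      exact μ.up_left_mem (by omega) (by omega) hc'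
    have h2 : {i} ×ˢ Finset.range (j + 1) ⊆ μ.cells := by
      rintro ⟨a, b⟩ hab
      simp only [Finset.mem_product, Finset.mem_range, Finset.mem_singleton] at hab
      exact μ.up_left_mem (by omega) (by omega) hc'
    have h3 := Finset.card_le_card h1
    have h4 := Finset.card_le_card h2
    simp only [Finset.card_product, Finset.card_range, Finset.card_singleton] at h3 h4
    change μ.cells.card ≤ m at hμ
    simp only [Finset.coe_product, Finset.coe_range, Set.mem_prod, Set.mem_Iio]
    omega
  · intro μ _ ν _ h
    exact YoungDiagram.ext h

/-- `μ ≺ ν`: the skew diagram `ν / μ` is a horizontal strip. -/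
def Interlaces (μ ν : YoungDiagram) : Prop :=
  ∀ i, μ.rowLen i ≤ ν.rowLen i ∧ ν.rowLen (i + 1) ≤ μ.rowLen i

theorem Interlaces.le {μ ν : YoungDiagram} (h : Interlaces μ ν) : μ ≤ ν := by
  rintro ⟨i, j⟩ hc
  change (i, j) ∈ μ at hc
  rw [mem_iff_lt_rowLen] at hc ⊢
  exact hc.trans_le (h i).1

theorem Interlaces.card_le {μ ν : YoungDiagram} (h : Interlaces μ ν) : μ.card ≤ ν.card :=
  card_mono h.le

theorem finite_setOf_interlaces (ν : YoungDiagram) : {μ | Interlaces μ ν}.Finite :=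
  (finite_setOf_card_le ν.card).subset fun _ h => Interlaces.card_le h

theorem exists_rowLen_eq_zero (μ ρ : YoungDiagram) :
    ∃ N, 0 < N ∧ μ.rowLen N = 0 ∧ ρ.rowLen N = 0 :=
  ⟨max (μ.colLen 0) (ρ.colLen 0) + 1, by omega, rowLen_eq_zero_iff.2 (by omega),
    rowLen_eq_zero_iff.2 (by omega)⟩

theorem rowLen_eq_zero_of_le {μ : YoungDiagram} {N i : ℕ} (h : μ.rowLen N = 0) (hi : N ≤ i) :
    μ.rowLen i = 0 :=
  Nat.le_zero.1 ((μ.rowLen_anti N i hi).trans_eq h)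

theorem rowLen_succ_le (μ : YoungDiagram) (i : ℕ) : μ.rowLen (i + 1) ≤ μ.rowLen i :=
  μ.rowLen_anti i (i + 1) (Nat.le_succ i)

/-- The rows of the diagram that the local growth rule attaches to `ν ≺ μ, ρ` and `k`. -/
def growRows (μ ρ ν : YoungDiagram) (k : ℕ) : ℕ → ℕ
  | 0 => max (μ.rowLen 0) (ρ.rowLen 0) + k
  | i + 1 => max (μ.rowLen (i + 1)) (ρ.rowLen (i + 1)) + min (μ.rowLen i) (ρ.rowLen i)
      - ν.rowLen i

/-- The rows of the diagram that the inverse local growth rule attaches to `μ, ρ ≺ ν`. -/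
def shrinkRows (μ ρ ν : YoungDiagram) (i : ℕ) : ℕ :=
  max (μ.rowLen (i + 1)) (ρ.rowLen (i + 1)) + min (μ.rowLen i) (ρ.rowLen i) - ν.rowLen (i + 1)

/-- Fomin's local growth rule for the Robinson-Schensted-Knuth correspondence, in the form of an
equivalence between the diagrams above and the diagrams below two given ones. -/
def growth (μ ρ : YoungDiagram) :
    {ν // Interlaces ν μ ∧ Interlaces ν ρ} × ℕ ≃ {ν // Interlaces μ ν ∧ Interlaces ρ ν} where
  -- Row `i` of a diagram below and row `i + 1` of a diagram above range over the same interval,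
  -- from `max (μ.rowLen (i + 1)) (ρ.rowLen (i + 1))` to `min (μ.rowLen i) (ρ.rowLen i)`. The rule
  -- reflects this interval; row `0` above has no upper bound, and its excess is `k`.
  toFun p := ⟨ofRows (growRows μ ρ p.1 p.2)
      (antitone_nat_of_succ_le fun i => by
        have h1 := p.1.2.1
        have h2 := p.1.2.2
        rcases i with _ | i
        · have := h1 0
          have := h2 0
          simp only [growRows]
          omega
        · have := h1 i
          have := h2 i
          have := h1 (i + 1)
          have := h2 (i + 1)
          simp only [growRows]
          omega)
      -- The new diagram may have one row more than both `μ` and `ρ`, hence the `+ 1`.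
      ((exists_rowLen_eq_zero μ ρ).choose + 1)
      (by
        have h := (exists_rowLen_eq_zero μ ρ).choose_spec
        have h1 := rowLen_eq_zero_of_le h.2.1 (Nat.le_succ _)
        have h2 := rowLen_eq_zero_of_le h.2.2 (Nat.le_succ _)
        simp only [growRows]
        simp only [Nat.succ_eq_add_one] at h1 h2
        omega), by
      have h1 := p.1.2.1
      have h2 := p.1.2.2
      constructor <;>
      · rintro (_ | i)
        · have := h1 0
          have := h2 0
          simp only [rowLen_ofRows, growRows]
          omega
        · have := h1 i
          have := h2 i
          have := h1 (i + 1)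
          have := h2 (i + 1)
          simp only [rowLen_ofRows, growRows]
          omega⟩
  invFun p := (⟨ofRows (shrinkRows μ ρ p.1)
      (antitone_nat_of_succ_le fun i => by
        have h1 := p.2.1
        have h2 := p.2.2
        have := h1 i
        have := h2 i
        have := h1 (i + 1)
        have := h2 (i + 1)
        have := h1 (i + 1 + 1)
        have := h2 (i + 1 + 1)
        simp only [shrinkRows]
        omega)
      ((exists_rowLen_eq_zero μ ρ).choose)
      (by
        have h := (exists_rowLen_eq_zero μ ρ).choose_spec
        have h1 := rowLen_eq_zero_of_le h.2.1 (Nat.le_succ _)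
        have h2 := rowLen_eq_zero_of_le h.2.2 (Nat.le_succ _)
        simp only [shrinkRows]
        simp only [Nat.succ_eq_add_one] at h1 h2
        omega), by
      have h1 := p.2.1
      have h2 := p.2.2
      constructor <;>
      · intro i
        have := h1 i
        have := h2 i
        have := h1 (i + 1)
        have := h2 (i + 1)
        simp only [rowLen_ofRows, shrinkRows]
        omega⟩, p.1.rowLen 0 - max (μ.rowLen 0) (ρ.rowLen 0))
  left_inv p := by
    have h1 := p.1.2.1
    have h2 := p.1.2.2
    refine Prod.ext (Subtype.ext (ext_rowLen fun i => ?_)) ?_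
    · have := h1 i
      have := h2 i
      simp only [rowLen_ofRows, shrinkRows, growRows]
      omega
    · simp only [rowLen_ofRows, growRows]
      omega
  right_inv p := by
    have h1 := p.2.1
    have h2 := p.2.2
    refine Subtype.ext (ext_rowLen fun i => ?_)
    rcases i with _ | i
    · have := h1 0
      have := h2 0
      simp only [rowLen_ofRows, growRows]
      omega
    · have := h1 i
      have := h2 i
      have := h1 (i + 1)
      have := h2 (i + 1)
      simp only [rowLen_ofRows, shrinkRows, growRows]
      omega

theorem rowLen_growth_zero (μ ρ : YoungDiagram) (p) :
    (growth μ ρ p).1.rowLen 0 = max (μ.rowLen 0) (ρ.rowLen 0) + p.2 := by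
  simp only [growth, Equiv.coe_fn_mk, rowLen_ofRows, growRows]

theorem rowLen_growth_succ (μ ρ : YoungDiagram) (p) (i : ℕ) :
    (growth μ ρ p).1.rowLen (i + 1) + p.1.1.rowLen i =
      max (μ.rowLen (i + 1)) (ρ.rowLen (i + 1)) + min (μ.rowLen i) (ρ.rowLen i) := by
  have := p.1.2.1 i
  have := p.1.2.2 i
  simp only [growth, Equiv.coe_fn_mk, rowLen_ofRows, growRows]
  omega

theorem Interlaces.rowLen_eq_zero {μ ν : YoungDiagram} (h : Interlaces μ ν) {N : ℕ}
    (hN : ν.rowLen N = 0) : μ.rowLen N = 0 :=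
  Nat.le_zero.1 ((h N).1.trans_eq hN)

theorem Interlaces.rowLen_succ_eq_zero {μ ν : YoungDiagram} (h : Interlaces μ ν) {N : ℕ}
    (hN : μ.rowLen N = 0) : ν.rowLen (N + 1) = 0 :=
  Nat.le_zero.1 ((h N).2.trans_eq hN)

/-- Sum the reflection rule over all rows: `max + min` is the sum of the two row lengths, and only
`k` is left over in row `0`. -/
theorem card_growth (μ ρ : YoungDiagram) (p) :
    (growth μ ρ p).1.card + p.1.1.card = μ.card + ρ.card + p.2 := by
  obtain ⟨N, -, hμ, hρ⟩ := exists_rowLen_eq_zero μ ρ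
  have hν := p.1.2.1.rowLen_eq_zero hμ
  have hl := (growth μ ρ p).2.1.rowLen_succ_eq_zero hμ
  have hμ' := rowLen_eq_zero_of_le hμ (Nat.le_succ N)
  have hρ' := rowLen_eq_zero_of_le hρ (Nat.le_succ N)
  rw [← sum_rowLen_eq hl, Finset.sum_range_succ', rowLen_growth_zero, ← sum_rowLen_eq hν,
    add_right_comm, ← Finset.sum_add_distrib,
    Finset.sum_congr rfl fun i _ => rowLen_growth_succ μ ρ p i, Finset.sum_add_distrib,
    add_right_comm, ← add_assoc, ← Finset.sum_range_succ' fun i => max (μ.rowLen i) (ρ.rowLen i),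
    Finset.sum_range_succ, hμ, hρ, max_self, add_zero, add_right_comm, ← Finset.sum_add_distrib,
    Finset.sum_congr rfl fun i _ => max_add_min (μ.rowLen i) (ρ.rowLen i),
    Finset.sum_add_distrib, sum_rowLen_eq hμ, sum_rowLen_eq hρ]

/-- Sum the reflection rule with weight `i + 1`: this is the weight of row `i + 1` above, and
exceeds by one that of row `i` below, whence the term `|ν|`. The number `k` drops out, since row `0`
has weight `0`. -/
theorem aStat_growth (μ : YoungDiagram) (p) :
    CharDegree.aStat (growth μ μ p).1 + CharDegree.aStat p.1.1 + p.1.1.card =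
      2 * CharDegree.aStat μ + μ.card := by
  obtain ⟨N, -, hμ, -⟩ := exists_rowLen_eq_zero μ μ
  have hν := p.1.2.1.rowLen_eq_zero hμ
  have hl := (growth μ μ p).2.1.rowLen_succ_eq_zero hμ
  have hμ' := rowLen_eq_zero_of_le hμ (Nat.le_succ N)
  have e1 : ∑ i ∈ Finset.range N, ((i + 1) * μ.rowLen (i + 1)) = CharDegree.aStat μ := by
    have := Finset.sum_range_succ' (fun i => i * μ.rowLen i) N
    rw [sum_mul_rowLen_eq hμ'] at this
    simpa using this.symm
  rw [← sum_mul_rowLen_eq hl, Finset.sum_range_succ', zero_mul, add_zero, ← sum_mul_rowLen_eq hν,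
    ← sum_rowLen_eq hν, two_mul]
  nth_rewrite 1 [← e1]
  rw [← sum_mul_rowLen_eq hμ, ← sum_rowLen_eq hμ, ← Finset.sum_add_distrib,
    ← Finset.sum_add_distrib, ← Finset.sum_add_distrib, ← Finset.sum_add_distrib]
  refine Finset.sum_congr rfl fun i _ => ?_
  have h := rowLen_growth_succ μ μ p i
  rw [max_self, min_self] at h
  linear_combination (i + 1) * h

end YoungDiagram

end

/-! ### Schur polynomials in finitely many variables and the branching rule. -/

noncomputable section

namespace CharDegree
open YoungDiagram

/-- The semistandard tableaux of shape `μ` with entries less than `n`. -/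
abbrev BoundedTableau (n : ℕ) (μ : YoungDiagram) : Type :=
  {T : SemistandardYoungTableau μ // ∀ i j, (i, j) ∈ μ → T i j < n}

theorem tableau_injective (μ : YoungDiagram) :
    Function.Injective fun (T : SemistandardYoungTableau μ) (c : μ.cells) => T c.1.1 c.1.2 := by
  intro T T' h
  ext i j
  by_cases hc : (i, j) ∈ μ
  · exact congrFun h ⟨(i, j), hc⟩
  · rw [T.zeros hc, T'.zeros hc]

instance (n : ℕ) (μ : YoungDiagram) : Finite (BoundedTableau n μ) :=
  Finite.of_injective (β := μ.cells → Fin n)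
    (fun T c => ⟨T.1 c.1.1 c.1.2, T.2 _ _ c.2⟩) fun _ _ h =>
      Subtype.ext <| tableau_injective μ <| funext fun c => congrArg Fin.val (congrFun h c)

instance (n : ℕ) (μ : YoungDiagram) : Fintype (BoundedTableau n μ) := Fintype.ofFinite _

/-- The Schur polynomial in the first `n` variables. -/
def schurFin (n : ℕ) (μ : YoungDiagram) (x : ℕ → ℝ) : ℝ :=
  ∑ T : BoundedTableau n μ, tableauTerm μ x T.1

/-- The shape of the cells of a tableau with entries less than `n`. -/
def innerShape {μ : YoungDiagram} (n : ℕ) (T : SemistandardYoungTableau μ) : YoungDiagram where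
  cells := μ.cells.filter fun c => T c.1 c.2 < n
  isLowerSet := by
    rintro ⟨i, j⟩ ⟨i', j'⟩ ⟨hi, hj⟩ h
    simp only [Finset.coe_filter, Set.mem_ofPred_eq, mem_cells] at h ⊢
    simp only at hi hj
    refine ⟨μ.up_left_mem hi hj h.1, lt_of_le_of_lt ?_ h.2⟩
    exact (T.row_weak_of_le hj (μ.up_left_mem hi le_rfl h.1)).trans (T.col_weak hi h.1)

theorem mem_innerShape {μ : YoungDiagram} {n : ℕ} {T : SemistandardYoungTableau μ} {i j : ℕ} :
    (i, j) ∈ innerShape n T ↔ (i, j) ∈ μ ∧ T i j < n := by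
  rw [← mem_cells]
  simp [innerShape]

/-- Columns increase strictly, so the cell above any cell of `μ` carries an entry less than `n`. -/
theorem innerShape_interlaces {μ : YoungDiagram} {n : ℕ} (T : BoundedTableau (n + 1) μ) :
    Interlaces (innerShape n T.1) μ := by
  intro i
  constructor
  · refine le_of_forall_lt fun j h => ?_
    rw [← mem_iff_lt_rowLen] at h ⊢
    exact (mem_innerShape.1 h).1
  · refine le_of_forall_lt fun j h => ?_
    rw [← mem_iff_lt_rowLen] at h ⊢
    refine mem_innerShape.2 ⟨μ.up_left_mem (Nat.le_succ i) le_rfl h, ?_⟩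
    have h1 := T.1.col_strict (Nat.lt_succ_self i) h
    have h2 := T.2 _ _ h
    simp only [Nat.succ_eq_add_one] at h1
    omega

/-- Tableaux with largest entries `n` on a given horizontal strip correspond to the tableaux with
entries less than `n` on the complement of the strip. -/
def branching {μ ν : YoungDiagram} (n : ℕ) (h : Interlaces ν μ) :
    {T : BoundedTableau (n + 1) μ // innerShape n T.1 = ν} ≃ BoundedTableau n ν where
  toFun T := ⟨
    { entry i j := if (i, j) ∈ ν then T.1.1 i j else 0
      row_weak' := by
        intro i j1 j2 hj hc
        rw [if_pos hc, if_pos (ν.up_left_mem le_rfl hj.le hc)]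
        exact T.1.1.row_weak hj (h.le hc)
      col_strict' := by
        intro i1 i2 j hi hc
        rw [if_pos hc, if_pos (ν.up_left_mem hi.le le_rfl hc)]
        exact T.1.1.col_strict hi (h.le hc)
      zeros' := fun hc => if_neg hc }, by
      intro i j hc
      change (if (i, j) ∈ ν then T.1.1 i j else 0) < n
      rw [if_pos hc]
      rw [← T.2] at hc
      exact (mem_innerShape.1 hc).2⟩
  invFun T := ⟨⟨
    { entry i j := if (i, j) ∈ ν then T.1 i j else if (i, j) ∈ μ then n else 0
      row_weak' := by
        intro i j1 j2 hj hc
        rw [if_pos hc, if_pos (μ.up_left_mem le_rfl hj.le hc)]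
        by_cases hc2 : (i, j2) ∈ ν
        · rw [if_pos hc2, if_pos (ν.up_left_mem le_rfl hj.le hc2)]
          exact T.1.row_weak hj hc2
        · rw [if_neg hc2]
          split_ifs with hc1
          · exact (T.2 _ _ hc1).le
          · exact le_rfl
      col_strict' := by
        intro i1 i2 j hi hc
        -- A cell of `μ` with another cell of `μ` below it lies in `ν`, because `μ / ν` is a
        -- horizontal strip. Hence the upper entry is less than `n`.
        have hc1 : (i1, j) ∈ ν := by
          rw [mem_iff_lt_rowLen] at hc ⊢
          exact hc.trans_le ((μ.rowLen_anti (i1 + 1) i2 hi).trans (h i1).2)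
        rw [if_pos hc, if_pos hc1]
        split_ifs with hc2
        · exact T.1.col_strict hi hc2
        · exact T.2 _ _ hc1
      zeros' := by
        intro i j hc
        rw [if_neg fun hc' => hc (h.le hc'), if_neg hc] }, by
      intro i j hc
      change (if (i, j) ∈ ν then T.1 i j else if (i, j) ∈ μ then n else 0) < n + 1
      rw [if_pos hc]
      split_ifs with hc1
      · exact (T.2 _ _ hc1).trans (Nat.lt_succ_self n)
      · exact Nat.lt_succ_self n⟩, by
      ext ⟨i, j⟩
      rw [mem_cells, mem_cells, mem_innerShape]
      change (i, j) ∈ μ ∧ (if (i, j) ∈ ν then T.1 i j else if (i, j) ∈ μ then n else 0) < n ↔ _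
      constructor
      · rintro ⟨h1, h2⟩
        by_contra hc
        rw [if_neg hc, if_pos h1] at h2
        exact lt_irrefl n h2
      · intro hc
        rw [if_pos hc]
        exact ⟨h.le hc, T.2 _ _ hc⟩⟩
  left_inv T := by
    refine Subtype.ext (Subtype.ext (SemistandardYoungTableau.ext fun i j => ?_))
    change (if (i, j) ∈ ν then (if (i, j) ∈ ν then T.1.1 i j else 0) else
      if (i, j) ∈ μ then n else 0) = T.1.1 i j
    split_ifs with h1 h2
    · rfl
    · rw [← T.2, mem_innerShape] at h1
      have := T.1.2 i j h2
      have : ¬ T.1.1 i j < n := fun h3 => h1 ⟨h2, h3⟩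
      omega
    · exact (T.1.1.zeros h2).symm
  right_inv T := by
    refine Subtype.ext (SemistandardYoungTableau.ext fun i j => ?_)
    change (if (i, j) ∈ ν then (if (i, j) ∈ ν then T.1 i j else
      if (i, j) ∈ μ then n else 0) else 0) = T.1 i j
    split_ifs with h1
    · rfl
    · exact (T.1.zeros h1).symm

theorem tableauTerm_branching {μ ν : YoungDiagram} (n : ℕ) (h : Interlaces ν μ) (x : ℕ → ℝ)
    (T : {T : BoundedTableau (n + 1) μ // innerShape n T.1 = ν}) :
    tableauTerm μ x T.1.1 = x n ^ (μ.card - ν.card) * tableauTerm ν x (branching n h T).1 := by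
  have hsub := cells_subset_iff.2 h.le
  rw [tableauTerm, ← Finset.prod_sdiff hsub, tableauTerm]
  congr 1
  · rw [YoungDiagram.card, YoungDiagram.card, ← Finset.card_sdiff_of_subset hsub]
    refine Finset.prod_eq_pow_card fun c hc => ?_
    obtain ⟨h1, h2⟩ := Finset.mem_sdiff.1 hc
    have h3 := T.1.2 c.1 c.2 h1
    have h4 : ¬ T.1.1 c.1 c.2 < n := by
      intro h4
      refine h2 ?_
      rw [mem_cells, ← T.2]
      exact mem_innerShape.2 ⟨h1, h4⟩
    rw [show T.1.1 c.1 c.2 = n by omega]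
  · refine Finset.prod_congr rfl fun c hc => congrArg x ?_
    exact (if_pos hc).symm

/-- The diagrams obtained by removing a horizontal strip. -/
def below (μ : YoungDiagram) : Finset YoungDiagram := (finite_setOf_interlaces μ).toFinset

theorem mem_below {μ ν : YoungDiagram} : ν ∈ below μ ↔ Interlaces ν μ := by
  simp [below]

/-- The tableaux are sorted by the shape of their entries less than `n`; the rest is a horizontal
strip filled with `n`. -/
theorem schurFin_succ (n : ℕ) (μ : YoungDiagram) (x : ℕ → ℝ) :
    schurFin (n + 1) μ x = ∑ ν ∈ below μ, x n ^ (μ.card - ν.card) * schurFin n ν x := by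
  classical
  rw [schurFin, ← Finset.sum_fiberwise_of_maps_to (s := Finset.univ) (t := below μ)
    (g := fun T : BoundedTableau (n + 1) μ => innerShape n T.1)
    fun T _ => mem_below.2 (innerShape_interlaces T)]
  refine Finset.sum_congr rfl fun ν hν => ?_
  have h := mem_below.1 hν
  rw [schurFin, Finset.mul_sum, ← Finset.sum_subtype_eq_sum_filter, Finset.subtype_univ]
  exact Fintype.sum_equiv (branching n h) _ _ fun T => tableauTerm_branching n h x T

theorem schurFin_zero_bot (x : ℕ → ℝ) : schurFin 0 ⊥ x = 1 := by
  have : Unique (BoundedTableau 0 ⊥) :=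
    { default := ⟨SemistandardYoungTableau.highestWeight ⊥, fun i j h => absurd h (notMem_bot _)⟩
      uniq := fun T => Subtype.ext (SemistandardYoungTableau.ext fun i j => by
        rw [T.1.zeros (notMem_bot _), SemistandardYoungTableau.zeros _ (notMem_bot _)]) }
  rw [schurFin, Fintype.sum_unique, tableauTerm, cells_bot, Finset.prod_empty]

theorem schurFin_zero {μ : YoungDiagram} (hμ : μ ≠ ⊥) (x : ℕ → ℝ) : schurFin 0 μ x = 0 := by
  have : IsEmpty (BoundedTableau 0 μ) := by
    refine ⟨fun T => hμ ?_⟩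
    ext ⟨i, j⟩
    rw [mem_cells, mem_cells]
    exact ⟨fun h => absurd (T.2 i j h) (Nat.not_lt_zero _), fun h => absurd h (notMem_bot _)⟩
  rw [schurFin, Fintype.sum_empty]

end CharDegree

end

/-! ### Littlewood's identity with sign, proved by the growth rule. -/

noncomputable section

namespace CharDegree
open YoungDiagram PowerSeries Filter Topology

/-- A tableau is determined by its entries on the cells, so any finite sum of `|x^T|` is bounded by
the expansion of `(∑ |x k|)^|μ|`. -/
theorem summable_tableauTerm (μ : YoungDiagram) {x : ℕ → ℝ} (hx : Summable x) :
    Summable (tableauTerm μ x) := by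
  classical
  refine Summable.of_abs (summable_of_sum_le (c := (∑' k, |x k|) ^ μ.card)
    (fun _ => abs_nonneg _) fun s => ?_)
  let e : SemistandardYoungTableau μ ↪ (μ.cells → ℕ) := ⟨_, tableau_injective μ⟩
  let t : Finset ℕ := s.biUnion fun T => μ.cells.image fun c => T c.1 c.2
  calc ∑ T ∈ s, |tableauTerm μ x T| = ∑ f ∈ s.map e, ∏ c, |x (f c)| := by
        rw [Finset.sum_map]
        refine Finset.sum_congr rfl fun T _ => ?_
        rw [tableauTerm, Finset.abs_prod, ← Finset.prod_coe_sort]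
        rfl
    _ ≤ ∑ f ∈ Fintype.piFinset fun _ : μ.cells => t, ∏ c, |x (f c)| := by
        refine Finset.sum_le_sum_of_subset_of_nonneg ?_ fun _ _ _ =>
          Finset.prod_nonneg fun _ _ => abs_nonneg _
        intro f hf
        obtain ⟨T, hT, rfl⟩ := Finset.mem_map.1 hf
        exact Fintype.mem_piFinset.2 fun c =>
          Finset.mem_biUnion.2 ⟨T, hT, Finset.mem_image.2 ⟨c.1, c.2, rfl⟩⟩
    _ = (∑ k ∈ t, |x k|) ^ μ.card := by
        rw [← Finset.prod_univ_sum (fun _ : μ.cells => t) fun _ k => |x k|, Finset.prod_const,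
          YoungDiagram.card, Finset.card_univ, Fintype.card_coe]
    _ ≤ _ := pow_le_pow_left₀ (Finset.sum_nonneg fun _ _ => abs_nonneg _)
        (hx.abs.sum_le_tsum t fun _ _ => abs_nonneg _) _

/-- The sets of tableaux with entries less than `n` exhaust all tableaux, so unconditional
convergence gives the limit along them. -/
theorem tendsto_schurFin (μ : YoungDiagram) {x : ℕ → ℝ} (hx : Summable x) :
    Tendsto (fun n => schurFin n μ x) atTop (𝓝 (schur μ x)) := by
  classical
  have h := (summable_tableauTerm μ hx).hasSum
  let S : ℕ → Finset (SemistandardYoungTableau μ) := fun n =>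
    (Finset.univ : Finset (BoundedTableau n μ)).map (Function.Embedding.subtype _)
  have hmem : ∀ n T, T ∈ S n ↔ ∀ i j, (i, j) ∈ μ → T i j < n := by
    intro n T
    simp [S]
  have hS : Tendsto S atTop atTop := by
    refine tendsto_atTop_finset_of_monotone ?_ ?_
    · intro m n hmn T hT
      rw [hmem] at hT ⊢
      exact fun i j hc => (hT i j hc).trans_le hmn
    · intro T
      refine ⟨(μ.cells.sup fun c => T c.1 c.2) + 1, (hmem _ _).2 fun i j hc => ?_⟩
      exact Nat.lt_succ_of_le (Finset.le_sup (f := fun c : ℕ × ℕ => T c.1 c.2) hc)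
  refine (h.comp hS).congr fun n => ?_
  simp only [Function.comp, S, schurFin, Finset.sum_map, Function.Embedding.subtype_apply]

/-- Each coefficient is then a finite sum. Nearly every interchange of summations below rests on
this. -/
theorem summable_of_X_pow_dvd {ι : Type*} {f : ι → ℝ⟦X⟧} (s : ι → ℕ) (h : ∀ i, X ^ s i ∣ f i)
    (hfin : ∀ m, {i | f i ≠ 0 ∧ s i ≤ m}.Finite) : Summable f := by
  refine (WithPiTopology.summable_iff_summable_coeff ℝ).2 fun m =>
    summable_of_hasFiniteSupport ((hfin m).subset fun i hi => ⟨?_, ?_⟩)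
  · rintro h0
    exact hi (by simp [h0])
  · by_contra hc
    exact hi (X_pow_dvd_iff.1 (h i) m (not_le.1 hc))

open Classical in
/-- The weight of the horizontal strip `μ / ν`, zero if `μ / ν` is not a horizontal strip. -/
def strip (x : ℝ⟦X⟧) (μ ν : YoungDiagram) : ℝ⟦X⟧ :=
  if Interlaces ν μ then x ^ (μ.card - ν.card) else 0

theorem strip_of_interlaces {x : ℝ⟦X⟧} {μ ν : YoungDiagram} (h : Interlaces ν μ) :
    strip x μ ν = x ^ (μ.card - ν.card) := if_pos h

theorem strip_of_not_interlaces {x : ℝ⟦X⟧} {μ ν : YoungDiagram} (h : ¬ Interlaces ν μ) :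
    strip x μ ν = 0 := if_neg h

theorem X_pow_dvd_strip {x : ℝ⟦X⟧} (hx : X ∣ x) (μ ν : YoungDiagram) :
    X ^ (μ.card - ν.card) ∣ strip x μ ν := by
  rw [strip]
  split_ifs
  · exact pow_dvd_pow_of_dvd hx _
  · exact dvd_zero _

/-- Summation over the diagrams above two given ones, by means of the local growth rule. -/
theorem one_sub_mul_tsum_growth (μ ρ : YoungDiagram) {z : ℝ⟦X⟧} (hz : X ∣ z)
    {f g : YoungDiagram → ℝ⟦X⟧} (hf : ∀ ν, ¬ (Interlaces μ ν ∧ Interlaces ρ ν) → f ν = 0)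
    (hg : ∀ ν, ¬ (Interlaces ν μ ∧ Interlaces ν ρ) → g ν = 0)
    (h : ∀ p, f (growth μ ρ p).1 = g p.1.1 * z ^ p.2) :
    (1 - z) * ∑' ν, f ν = ∑' ν, g ν := by
  have hz0 : z.constantCoeff = 0 := X_dvd_iff.1 hz
  have hfin : Finite {ν // Interlaces ν μ ∧ Interlaces ν ρ} :=
    ((finite_setOf_interlaces μ).subset fun ν hν => hν.1).to_subtype
  have hgs : Summable fun ν : {ν // Interlaces ν μ ∧ Interlaces ν ρ} => g ν :=
    summable_of_hasFiniteSupport (Set.toFinite _)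
  have hzs := WithPiTopology.summable_pow_of_constantCoeff_eq_zero hz0
  have hprod : Summable fun p : {ν // Interlaces ν μ ∧ Interlaces ν ρ} × ℕ => g p.1 * z ^ p.2 := by
    refine summable_of_X_pow_dvd (fun p => p.2)
      (fun p => (pow_dvd_pow_of_dvd hz p.2).mul_left _) fun m => ?_
    refine ((Set.finite_univ.prod (Set.finite_Iic m))).subset fun p hp => ⟨trivial, hp.2⟩
  have e1 : ∑' ν, f ν = ∑' ν : {ν // Interlaces μ ν ∧ Interlaces ρ ν}, f ν :=
    (tsum_subtype_eq_of_support_subset (s := {ν | Interlaces μ ν ∧ Interlaces ρ ν})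
      fun ν hν => by_contra fun hc => hν (hf ν hc)).symm
  have e2 : ∑' ν, g ν = ∑' ν : {ν // Interlaces ν μ ∧ Interlaces ν ρ}, g ν :=
    (tsum_subtype_eq_of_support_subset (s := {ν | Interlaces ν μ ∧ Interlaces ν ρ})
      fun ν hν => by_contra fun hc => hν (hg ν hc)).symm
  rw [e1, e2, ← (growth μ ρ).tsum_eq]
  simp only [h]
  rw [← hgs.tsum_mul_tsum hzs hprod, mul_left_comm,
    WithPiTopology.one_sub_mul_tsum_pow_of_constantCoeff_eq_zero hz0, mul_one]

/-- The commutation rule between adding and removing a horizontal strip. By `card_growth` each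
diagram above carries the weight of the matching one below times `(x * y) ^ k`, and the geometric
series in `k` is cancelled by `1 - x * y`. -/
theorem one_sub_mul_tsum_strip_mul_strip {x y : ℝ⟦X⟧} (hx : X ∣ x) (μ ρ : YoungDiagram) :
    (1 - x * y) * ∑' ν, strip y ν μ * strip x ν ρ = ∑' ν, strip x μ ν * strip y ρ ν := by
  refine one_sub_mul_tsum_growth μ ρ (hx.mul_right y) ?_ ?_ fun p => ?_
  · intro ν hν
    by_cases h : Interlaces μ ν
    · rw [strip_of_not_interlaces fun h' => hν ⟨h, h'⟩, mul_zero]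
    · rw [strip_of_not_interlaces h, zero_mul]
  · intro ν hν
    by_cases h : Interlaces ν μ
    · rw [strip_of_not_interlaces fun h' => hν ⟨h, h'⟩, mul_zero]
    · rw [strip_of_not_interlaces h, zero_mul]
  · have h := card_growth μ ρ p
    have h1 := p.1.2.1.card_le
    have h2 := p.1.2.2.card_le
    rw [strip_of_interlaces (growth μ ρ p).2.1, strip_of_interlaces (growth μ ρ p).2.2,
      strip_of_interlaces p.1.2.1, strip_of_interlaces p.1.2.2,
      show (growth μ ρ p).1.card - μ.card = ρ.card - p.1.1.card + p.2 by omega,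
      show (growth μ ρ p).1.card - ρ.card = μ.card - p.1.1.card + p.2 by omega]
    ring

/-- The growth rule with both diagrams equal to `μ`. By `aStat_growth` the statistics above and
below differ modulo `2` by the size of the removed strip, which is why `x` becomes `b * x`. -/
theorem one_sub_mul_tsum_sign_mul_strip {b : ℝ⟦X⟧} (hb : b ^ 2 = 1) {x : ℝ⟦X⟧} (hx : X ∣ x)
    (μ : YoungDiagram) :
    (1 - x) * ∑' ν, b ^ aStat ν * strip x ν μ = ∑' ν, b ^ aStat ν * strip (b * x) μ ν := by
  refine one_sub_mul_tsum_growth μ μ hx ?_ ?_ fun p => ?_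
  · intro ν hν
    rw [strip_of_not_interlaces fun h' => hν ⟨h', h'⟩, mul_zero]
  · intro ν hν
    rw [strip_of_not_interlaces fun h' => hν ⟨h', h'⟩, mul_zero]
  · have h := card_growth μ μ p
    have h' := aStat_growth μ p
    have h1 := p.1.2.1.card_le
    rw [strip_of_interlaces (growth μ μ p).2.1, strip_of_interlaces p.1.2.1,
      show (growth μ μ p).1.card - μ.card = μ.card - p.1.1.card + p.2 by omega, mul_pow]
    have key : b ^ aStat (growth μ μ p).1 = b ^ aStat p.1.1 * b ^ (μ.card - p.1.1.card) := by
      have e : aStat (growth μ μ p).1 + 2 * aStat p.1.1 =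
          aStat p.1.1 + (μ.card - p.1.1.card) + 2 * aStat μ := by omega
      have := congrArg (fun k => b ^ k) e
      simpa only [pow_add, pow_mul, hb, one_pow, mul_one] using this
    rw [key]
    ring

section Littlewood

variable (c : ℕ → ℝ) (d : ℕ)

/-- The Schur polynomial in the variables `c 0 * X ^ d, c 1 * X ^ d, …`. -/
def schurSeries (n : ℕ) (μ : YoungDiagram) : ℝ⟦X⟧ := C (schurFin n μ c) * X ^ (μ.card * d)

theorem schurSeries_succ (n : ℕ) (μ : YoungDiagram) :
    schurSeries c d (n + 1) μ = ∑' ν, strip (C (c n) * X ^ d) μ ν * schurSeries c d n ν := by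
  rw [tsum_eq_sum (s := below μ) fun ν hν => by
    rw [strip_of_not_interlaces fun h => hν (mem_below.2 h), zero_mul]]
  rw [schurSeries, schurFin_succ, map_sum, Finset.sum_mul]
  refine Finset.sum_congr rfl fun ν hν => ?_
  have h := mem_below.1 hν
  obtain ⟨k, hk⟩ := Nat.exists_eq_add_of_le h.card_le
  rw [strip_of_interlaces h, schurSeries, map_mul, map_pow, hk, Nat.add_sub_cancel_left]
  ring

variable {d}

theorem X_dvd_C_mul_X_pow (hd : d ≠ 0) (a : ℝ) : (X : ℝ⟦X⟧) ∣ C a * X ^ d :=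
  (dvd_pow_self X hd).mul_left _

theorem schurSeries_zero (μ : YoungDiagram) (hμ : μ ≠ ⊥) : schurSeries c d 0 μ = 0 := by
  rw [schurSeries, schurFin_zero hμ, map_zero, zero_mul]

theorem schurSeries_zero_bot : schurSeries c d 0 ⊥ = 1 := by
  rw [schurSeries, schurFin_zero_bot, map_one, one_mul, YoungDiagram.card, cells_bot,
    Finset.card_empty, zero_mul, pow_zero]

theorem aStat_bot : aStat ⊥ = 0 := by
  rw [← sum_mul_rowLen_eq (N := 0), Finset.sum_range_zero]
  by_contra h
  exact notMem_bot (0, 0) (mem_iff_lt_rowLen.2 (Nat.pos_of_ne_zero h))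

theorem summable_mul_strip_mul (s : YoungDiagram → ℕ) (a f : YoungDiagram → ℝ⟦X⟧) (x : ℝ⟦X⟧)
    (ha : ∀ ν, X ^ s ν ∣ a ν) (hs : ∀ m, {ν | s ν ≤ m}.Finite) :
    Summable (Function.uncurry fun ν μ => a ν * (strip x ν μ * f μ)) := by
  refine summable_of_X_pow_dvd (fun p => s p.1) (fun p => (ha _).mul_right _) fun m => ?_
  refine ((hs m).biUnion fun ν _ => (finite_setOf_interlaces ν).image fun μ => (ν, μ)).subset ?_
  rintro ⟨ν, μ⟩ ⟨h1, h2⟩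
  have h3 : Interlaces μ ν := by
    by_contra hc
    exact h1 (by simp [Function.uncurry, strip_of_not_interlaces hc])
  simp only [Set.mem_iUnion, Set.mem_image]
  exact ⟨ν, h2, μ, h3, rfl⟩

theorem finite_setOf_card_sub_le (k m : ℕ) : {ν : YoungDiagram | ν.card - k ≤ m}.Finite :=
  (finite_setOf_card_le (m + k)).subset fun ν hν => by
    simp only [Set.mem_ofPred_eq] at hν ⊢
    omega

theorem summable_strip_mul_strip {x y : ℝ⟦X⟧} (hx : X ∣ x) (μ ρ : YoungDiagram) :
    Summable fun ν => strip x ν μ * strip y ν ρ :=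
  summable_of_X_pow_dvd (fun ν => ν.card - μ.card)
    (fun _ => (X_pow_dvd_strip hx _ _).mul_right _)
    fun m => (finite_setOf_card_sub_le _ m).subset fun _ h => h.2

/-- A strip of weight `y` is moved past the `n` strips that build the Schur polynomial. Passing the
variable `x_i` costs the factor `1 - x_i * y`, and once no variable is left only the empty diagram
survives. -/
theorem prod_mul_tsum_strip_mul_schurSeries (hd : d ≠ 0) {y : ℝ⟦X⟧} (hy : X ∣ y) (n : ℕ)
    (ν : YoungDiagram) :
    (∏ i ∈ Finset.range n, (1 - C (c i) * X ^ d * y)) * ∑' μ, strip y μ ν * schurSeries c d n μ =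
      schurSeries c d n ν := by
  induction n generalizing ν with
  | zero =>
    rw [Finset.prod_range_zero, one_mul, tsum_eq_single ⊥ fun μ hμ => by
      rw [schurSeries_zero c μ hμ, mul_zero], schurSeries_zero_bot, mul_one]
    by_cases h : ν = ⊥
    · rw [h, schurSeries_zero_bot, strip_of_interlaces fun i =>
        ⟨le_rfl, rowLen_succ_le _ i⟩, Nat.sub_self, pow_zero]
    · rw [schurSeries_zero c ν h, strip_of_not_interlaces fun h' => h (le_bot_iff.1 h'.le)]
  | succ n ih =>
    set x : ℝ⟦X⟧ := C (c n) * X ^ d with hxdef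
    have hx : X ∣ x := X_dvd_C_mul_X_pow hd _
    have e : ∑' μ, strip y μ ν * schurSeries c d (n + 1) μ =
        ∑' ρ, (∑' μ, strip y μ ν * strip x μ ρ) * schurSeries c d n ρ := by
      have hs := summable_mul_strip_mul (fun μ => μ.card - ν.card) (fun μ => strip y μ ν)
        (schurSeries c d n) x (fun μ => X_pow_dvd_strip hy _ _) (finite_setOf_card_sub_le _)
      calc _ = ∑' μ, ∑' ρ, strip y μ ν * (strip x μ ρ * schurSeries c d n ρ) := by
            refine tsum_congr fun μ => ?_
            rw [schurSeries_succ, ← Summable.tsum_mul_left]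
            refine summable_of_hasFiniteSupport ((finite_setOf_interlaces μ).subset fun ρ hρ => ?_)
            by_contra hc
            exact hρ (by simp only [strip_of_not_interlaces hc, zero_mul])
        _ = ∑' ρ, ∑' μ, strip y μ ν * (strip x μ ρ * schurSeries c d n ρ) := hs.tsum_comm.symm
        _ = _ := by
            refine tsum_congr fun ρ => ?_
            rw [← Summable.tsum_mul_right _ (summable_strip_mul_strip hy ν ρ)]
            simp only [mul_assoc]
    have e2 : (1 - x * y) * ∑' μ, strip y μ ν * schurSeries c d (n + 1) μ =
        ∑' κ, strip x ν κ * ∑' ρ, strip y ρ κ * schurSeries c d n ρ := by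
      have hs : Summable (Function.uncurry fun ρ κ =>
          strip x ν κ * strip y ρ κ * schurSeries c d n ρ) := by
        refine summable_of_X_pow_dvd (fun p => p.1.card - p.2.card)
          (fun p => ((X_pow_dvd_strip hy _ _).mul_left _).mul_right _) fun m => ?_
        refine ((finite_setOf_card_sub_le ν.card m).prod (finite_setOf_interlaces ν)).subset ?_
        rintro ⟨ρ, κ⟩ ⟨h1, h2⟩
        have h3 : Interlaces κ ν := by
          by_contra hc
          exact h1 (by simp [Function.uncurry, strip_of_not_interlaces hc])
        have := h3.card_le
        simp only at h2
        exact ⟨show ρ.card - ν.card ≤ m by omega, h3⟩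
      calc _ = ∑' ρ, (1 - x * y) * ((∑' μ, strip y μ ν * strip x μ ρ) * schurSeries c d n ρ) := by
            rw [e, Summable.tsum_mul_left]
            refine summable_of_X_pow_dvd (fun ρ => ρ.card * d)
              (fun ρ => (Dvd.intro_left _ rfl : _ ∣ schurSeries c d n ρ).mul_left _) fun m =>
              (finite_setOf_card_le m).subset fun ρ hρ => ?_
            exact (Nat.le_mul_of_pos_right _ (Nat.pos_of_ne_zero hd)).trans hρ.2
        _ = ∑' ρ, ∑' κ, strip x ν κ * strip y ρ κ * schurSeries c d n ρ := by
            refine tsum_congr fun ρ => ?_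
            rw [← mul_assoc, one_sub_mul_tsum_strip_mul_strip hx, Summable.tsum_mul_right]
            refine summable_of_hasFiniteSupport ((finite_setOf_interlaces ν).subset fun κ hκ => ?_)
            by_contra hc
            exact hκ (by simp only [strip_of_not_interlaces hc, zero_mul])
        _ = ∑' κ, ∑' ρ, strip x ν κ * strip y ρ κ * schurSeries c d n ρ := hs.tsum_comm.symm
        _ = _ := by
            refine tsum_congr fun κ => ?_
            rw [← Summable.tsum_mul_left]
            · simp only [mul_assoc]
            · refine summable_of_X_pow_dvd (fun ρ => ρ.card * d)
                (fun ρ => (Dvd.intro_left _ rfl : _ ∣ schurSeries c d n ρ).mul_left _) fun m =>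
                (finite_setOf_card_le m).subset fun ρ hρ => ?_
              exact (Nat.le_mul_of_pos_right _ (Nat.pos_of_ne_zero hd)).trans hρ.2
    rw [Finset.prod_range_succ, mul_assoc, e2, schurSeries_succ, ← Summable.tsum_mul_left]
    · refine tsum_congr fun κ => ?_
      rw [mul_left_comm, ih κ]
    · refine summable_of_hasFiniteSupport ((finite_setOf_interlaces ν).subset fun κ hκ => ?_)
      by_contra hc
      exact hκ (by simp only [strip_of_not_interlaces hc, zero_mul])

theorem summable_mul_X_pow_card (hd : d ≠ 0) (f g : YoungDiagram → ℝ⟦X⟧) :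
    Summable fun μ => f μ * (g μ * X ^ (μ.card * d)) :=
  summable_of_X_pow_dvd (fun ρ => ρ.card * d)
    (fun _ => (Dvd.intro_left _ rfl).mul_left _) fun m =>
    (finite_setOf_card_le m).subset fun _ hρ =>
      (Nat.le_mul_of_pos_right _ (Nat.pos_of_ne_zero hd)).trans hρ.2

/-- Branching splits off the last variable `x`; the sum over the outer diagram turns it into the
removal of a strip of weight `b * x`, at the cost of `1 - x`; the remaining sum is evaluated by
`prod_mul_tsum_strip_mul_schurSeries` with `y = b * x`. -/
theorem prod_mul_tsum_sign_mul_schurSeries_succ (hd : d ≠ 0) {b : ℝ⟦X⟧} (hb : b ^ 2 = 1)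
    (n : ℕ) :
    ((1 - C (c n) * X ^ d) *
      ∏ i ∈ Finset.range n, (1 - C (c i) * X ^ d * (b * (C (c n) * X ^ d)))) *
        ∑' μ, b ^ aStat μ * schurSeries c d (n + 1) μ = ∑' μ, b ^ aStat μ * schurSeries c d n μ := by
  set x : ℝ⟦X⟧ := C (c n) * X ^ d with hxdef
  have hx : X ∣ x := X_dvd_C_mul_X_pow hd _
  have hs : Summable (Function.uncurry fun μ ρ =>
      b ^ aStat μ * (strip x μ ρ * schurSeries c d n ρ)) := by
    -- Both terms of the exponent are needed: together they bound the sizes of both diagrams.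
    refine summable_of_X_pow_dvd (fun p => (p.1.card - p.2.card) + p.2.card)
      (fun p => ?_) fun m => ?_
    · rw [pow_add]
      refine (mul_dvd_mul (X_pow_dvd_strip hx _ _) ?_).mul_left _
      refine (pow_dvd_pow X ?_).trans (Dvd.intro_left _ rfl : _ ∣ schurSeries c d n p.2)
      exact Nat.le_mul_of_pos_right _ (Nat.pos_of_ne_zero hd)
    · refine ((finite_setOf_card_le m).prod (finite_setOf_card_le m)).subset ?_
      rintro ⟨μ, ρ⟩ ⟨h1, h2⟩
      simp only [Set.mem_prod, Set.mem_ofPred_eq] at h2 ⊢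
      omega
  have e : ∑' μ, b ^ aStat μ * schurSeries c d (n + 1) μ =
      ∑' ρ, (∑' μ, b ^ aStat μ * strip x μ ρ) * schurSeries c d n ρ := by
    calc _ = ∑' μ, ∑' ρ, b ^ aStat μ * (strip x μ ρ * schurSeries c d n ρ) := by
          refine tsum_congr fun μ => ?_
          rw [schurSeries_succ, ← Summable.tsum_mul_left]
          refine summable_of_hasFiniteSupport ((finite_setOf_interlaces μ).subset fun ρ hρ => ?_)
          by_contra hc
          exact hρ (by simp only [strip_of_not_interlaces hc, zero_mul])
      _ = ∑' ρ, ∑' μ, b ^ aStat μ * (strip x μ ρ * schurSeries c d n ρ) := hs.tsum_comm.symm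
      _ = _ := by
          refine tsum_congr fun ρ => ?_
          rw [← Summable.tsum_mul_right]
          · simp only [mul_assoc]
          · exact summable_of_X_pow_dvd (fun μ => μ.card - ρ.card)
              (fun μ => (X_pow_dvd_strip hx _ _).mul_left _)
              fun m => (finite_setOf_card_sub_le _ m).subset fun _ h => h.2
  have hs2 : Summable (Function.uncurry fun ρ κ =>
      b ^ aStat κ * strip (b * x) ρ κ * schurSeries c d n ρ) := by
    refine summable_of_X_pow_dvd (fun p => p.1.card) (fun p => ?_) fun m => ?_
    · refine ((pow_dvd_pow X ?_).trans (Dvd.intro_left _ rfl : _ ∣ schurSeries c d n p.1)).mul_left _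
      exact Nat.le_mul_of_pos_right _ (Nat.pos_of_ne_zero hd)
    · refine ((finite_setOf_card_le m).prod (finite_setOf_card_le m)).subset ?_
      rintro ⟨ρ, κ⟩ ⟨h1, h2⟩
      have h3 : Interlaces κ ρ := by
        by_contra hc
        exact h1 (by simp [Function.uncurry, strip_of_not_interlaces hc])
      have := h3.card_le
      simp only [Set.mem_prod, Set.mem_ofPred_eq] at h2 ⊢
      omega
  have e2 : (1 - x) * ∑' μ, b ^ aStat μ * schurSeries c d (n + 1) μ =
      ∑' κ, b ^ aStat κ * ∑' ρ, strip (b * x) ρ κ * schurSeries c d n ρ := by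
    calc _ = ∑' ρ, (1 - x) * ((∑' μ, b ^ aStat μ * strip x μ ρ) * schurSeries c d n ρ) := by
          rw [e, Summable.tsum_mul_left]
          exact summable_mul_X_pow_card hd _ _
      _ = ∑' ρ, ∑' κ, b ^ aStat κ * strip (b * x) ρ κ * schurSeries c d n ρ := by
          refine tsum_congr fun ρ => ?_
          rw [← mul_assoc, one_sub_mul_tsum_sign_mul_strip hb hx, Summable.tsum_mul_right]
          refine summable_of_hasFiniteSupport ((finite_setOf_interlaces ρ).subset fun κ hκ => ?_)
          by_contra hc
          exact hκ (by simp only [strip_of_not_interlaces hc, mul_zero])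
      _ = ∑' κ, ∑' ρ, b ^ aStat κ * strip (b * x) ρ κ * schurSeries c d n ρ := hs2.tsum_comm.symm
      _ = _ := by
          refine tsum_congr fun κ => ?_
          rw [← Summable.tsum_mul_left]
          · simp only [mul_assoc]
          · exact summable_mul_X_pow_card hd _ _
  rw [mul_comm (1 - x), mul_assoc, e2, ← Summable.tsum_mul_left]
  · refine tsum_congr fun κ => ?_
    rw [mul_left_comm, prod_mul_tsum_strip_mul_schurSeries c hd (hx.mul_left b)]
  · refine hs2.prod_symm.prod.congr fun κ => ?_
    rw [← Summable.tsum_mul_left]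
    · simp only [mul_assoc, Function.uncurry, Prod.swap]
    · exact summable_mul_X_pow_card hd _ _

theorem tsum_sign_mul_schurSeries_mul_prod (hd : d ≠ 0) {b : ℝ⟦X⟧} (hb : b ^ 2 = 1) (n : ℕ) :
    (∑' μ, b ^ aStat μ * schurSeries c d n μ) * ∏ j ∈ Finset.range n, ((1 - C (c j) * X ^ d) *
      ∏ i ∈ Finset.range j, (1 - C (c i) * X ^ d * (b * (C (c j) * X ^ d)))) = 1 := by
  induction n with
  | zero =>
    rw [Finset.prod_range_zero, mul_one, tsum_eq_single ⊥ fun μ hμ => by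
      rw [schurSeries_zero c μ hμ, mul_zero], schurSeries_zero_bot, aStat_bot, pow_zero,
      mul_one]
  | succ n ih =>
    rw [Finset.prod_range_succ, mul_left_comm, mul_comm (∑' μ, _),
      prod_mul_tsum_sign_mul_schurSeries_succ c hd hb, mul_comm, ih]

/-- A fixed coefficient involves only the finitely many diagrams with at most `m` cells, so the
limit may be taken term by term. -/
theorem tendsto_tsum_sign_mul_schurSeries (hd : d ≠ 0) (hc : Summable c) (b : ℝ) :
    Tendsto (fun n => ∑' μ, C b ^ aStat μ * schurSeries c d n μ) atTop
      (𝓝 (∑' μ, C (b ^ aStat μ * schur μ c) * X ^ (μ.card * d))) := by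
  rw [WithPiTopology.tendsto_iff_coeff_tendsto]
  intro m
  have key : ∀ a : YoungDiagram → ℝ,
      coeff m (∑' μ, C (b ^ aStat μ * a μ) * X ^ (μ.card * d) : ℝ⟦X⟧) =
        ∑ μ ∈ (finite_setOf_card_le m).toFinset,
          coeff m (C (b ^ aStat μ * a μ) * X ^ (μ.card * d) : ℝ⟦X⟧) := by
    intro a
    have hs : Summable fun μ : YoungDiagram =>
        (C (b ^ aStat μ * a μ) * X ^ (μ.card * d) : ℝ⟦X⟧) := by
      simpa using summable_mul_X_pow_card hd (fun _ => 1) fun μ => C (b ^ aStat μ * a μ)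
    rw [← (((WithPiTopology.hasSum_iff_hasSum_coeff ℝ).1 hs.hasSum) m).tsum_eq]
    refine tsum_eq_sum fun μ hμ => ?_
    rw [coeff_C_mul, coeff_X_pow, if_neg, mul_zero]
    rintro rfl
    refine hμ ?_
    simpa using Nat.le_mul_of_pos_right _ (Nat.pos_of_ne_zero hd)
  rw [key fun μ => schur μ c]
  refine Tendsto.congr (fun n => ?_) (tendsto_finsetSum _ fun μ _ => ?_)
    (f₁ := fun n => ∑ μ ∈ (finite_setOf_card_le m).toFinset,
      coeff m (C (b ^ aStat μ * schurFin n μ c) * X ^ (μ.card * d) : ℝ⟦X⟧))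
  · rw [← key]
    simp only [schurSeries, map_mul, map_pow, mul_assoc]
  · simp only [coeff_C_mul]
    exact (tendsto_const_nhds.mul (tendsto_schurFin μ hc)).mul_const _

end Littlewood

end CharDegree

end

/-! ### Self-dual irreducible polynomials over a finite field and their number. -/

noncomputable section

namespace CharDegree
open Polynomial

section Dual

variable {F : Type*} [Field F]

theorem natDegree_reverse_of_coeff_zero {f : F[X]} (h : f.coeff 0 ≠ 0) :
    f.reverse.natDegree = f.natDegree := by
  rw [reverse_natDegree, natTrailingDegree_eq_zero.2 (Or.inr h), Nat.sub_zero]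

theorem reverse_reverse_of_coeff_zero {f : F[X]} (h : f.coeff 0 ≠ 0) :
    f.reverse.reverse = f := by
  ext n
  rw [coeff_reverse, coeff_reverse, natDegree_reverse_of_coeff_zero h, revAt_invol]

theorem natDegree_dualPoly {f : F[X]} (h : f.coeff 0 ≠ 0) :
    (dualPoly f).natDegree = f.natDegree := by
  rw [dualPoly, natDegree_C_mul (inv_ne_zero h), natDegree_reverse_of_coeff_zero h]

theorem monic_dualPoly {f : F[X]} (h : f.coeff 0 ≠ 0) : (dualPoly f).Monic := by
  rw [Monic, dualPoly, leadingCoeff_mul, leadingCoeff_C, reverse_leadingCoeff, trailingCoeff,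
    natTrailingDegree_eq_zero.2 (Or.inr h), inv_mul_cancel₀ h]

theorem coeff_zero_dualPoly {f : F[X]} (hf : f.Monic) : (dualPoly f).coeff 0 = (f.coeff 0)⁻¹ := by
  rw [dualPoly, coeff_C_mul, coeff_zero_reverse, hf.leadingCoeff, mul_one]

theorem dualPoly_dualPoly {f : F[X]} (hf : f.Monic) (h : f.coeff 0 ≠ 0) :
    dualPoly (dualPoly f) = f := by
  rw [dualPoly, coeff_zero_dualPoly hf, inv_inv, dualPoly, reverse_mul_of_domain, reverse_C,
    reverse_reverse_of_coeff_zero h, ← mul_assoc, ← C_mul, mul_inv_cancel₀ h, C_1, one_mul]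

/-- Reversal is multiplicative, and an involution on polynomials with nonzero constant term. Factors
of `f.reverse` are of this kind, since its constant term is the leading coefficient of `f`. -/
theorem irreducible_reverse {f : F[X]} (hf : Irreducible f) (h : f.coeff 0 ≠ 0) :
    Irreducible f.reverse := by
  have key : ∀ g : F[X], g.coeff 0 ≠ 0 → IsUnit g.reverse → IsUnit g := by
    intro g hg hu
    rw [isUnit_iff_degree_eq_zero] at hu ⊢
    have h0 : g ≠ 0 := fun h0 => hg (by rw [h0, coeff_zero])
    have := natDegree_eq_of_degree_eq_some hu
    rw [natDegree_reverse_of_coeff_zero hg] at this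
    rw [degree_eq_natDegree h0, this]
    rfl
  refine ⟨fun hu => hf.not_isUnit (key f h hu), fun a b hab => ?_⟩
  have h0 : a.coeff 0 * b.coeff 0 ≠ 0 := by
    rw [← mul_coeff_zero, ← hab, coeff_zero_reverse]
    exact leadingCoeff_ne_zero.2 hf.ne_zero
  have := congrArg reverse hab
  rw [reverse_reverse_of_coeff_zero h, reverse_mul_of_domain] at this
  rcases hf.isUnit_or_isUnit this with hu | hu
  · exact Or.inl (key a (left_ne_zero_of_mul h0) hu)
  · exact Or.inr (key b (right_ne_zero_of_mul h0) hu)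

theorem dualPoly_mem_monicIrred {f : F[X]} (hf : f ∈ monicIrred F) :
    dualPoly f ∈ monicIrred F := by
  refine ⟨monic_dualPoly hf.2.2, ?_, ?_⟩
  · rw [dualPoly, irreducible_isUnit_mul (isUnit_C.2 (inv_ne_zero hf.2.2).isUnit)]
    exact irreducible_reverse hf.2.1 hf.2.2
  · rw [coeff_zero_dualPoly hf.1]
    exact inv_ne_zero hf.2.2

theorem aeval_inv_dualPoly_eq_zero_iff {L : Type*} [Field L] [Algebra F L] {f : F[X]}
    (h : f.coeff 0 ≠ 0) {a : L} (ha : a ≠ 0) :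
    aeval a⁻¹ (dualPoly f) = 0 ↔ aeval a f = 0 := by
  let : Invertible a := invertibleOfNonzero ha
  rw [dualPoly, map_mul, aeval_C, mul_eq_zero, or_iff_right, aeval_def, aeval_def,
    ← eval₂_reverse_eq_zero_iff (algebraMap F L) a f, invOf_eq_inv]
  rw [map_eq_zero_iff _ (algebraMap F L).injective]
  exact inv_ne_zero h

theorem eq_of_common_root {L : Type*} [Field L] [Algebra F L] {f g : F[X]} (hf : f.Monic)
    (hf' : Irreducible f) (hg : g.Monic) (hg' : Irreducible g) {a : L} (h1 : aeval a f = 0)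
    (h2 : aeval a g = 0) : f = g :=
  (minpoly.eq_of_irreducible_of_monic hf' h1 hf).trans
    (minpoly.eq_of_irreducible_of_monic hg' h2 hg).symm

/-- The dual of `f` has the root `a⁻¹`, and a monic irreducible polynomial is determined by any one
of its roots. -/
theorem eq_dualPoly_iff {L : Type*} [Field L] [Algebra F L] {f : F[X]} (hf : f ∈ monicIrred F)
    {a : L} (ha : a ≠ 0) (h : aeval a f = 0) : f = dualPoly f ↔ aeval a⁻¹ f = 0 := by
  have hd := dualPoly_mem_monicIrred hf
  have h1 := (aeval_inv_dualPoly_eq_zero_iff hf.2.2 ha).2 h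
  constructor
  · intro he
    rwa [← he] at h1
  · intro h2
    exact eq_of_common_root hf.1 hf.2.1 hd.1 hd.2.1 h2 h1

end Dual

section Frobenius

theorem aeval_root_eq_zero_iff {F : Type*} [Field F] {f : F[X]} (g : F[X]) :
    aeval (AdjoinRoot.root f) g = 0 ↔ f ∣ g := by
  rw [AdjoinRoot.aeval_eq, AdjoinRoot.mk_eq_zero]

theorem dvd_X_sq_sub_one_iff {F : Type*} [Field F] {f : F[X]} :
    f ∣ X ^ 2 - 1 ↔ AdjoinRoot.root f * AdjoinRoot.root f = 1 := by
  rw [← aeval_root_eq_zero_iff, map_sub, map_pow, aeval_X, map_one, sub_eq_zero, sq]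

theorem dvd_X_sq_sub_one_iff_eq {F : Type*} [Field F] {f : F[X]} (hf : f ∈ monicIrred F) :
    f ∣ X ^ 2 - 1 ↔ f = X - C 1 ∨ f = X - C (-1) := by
  have e : (X ^ 2 - 1 : F[X]) = (X - C 1) * (X - C (-1)) := by
    rw [C_neg, C_1]
    ring
  rw [e]
  constructor
  · intro h
    refine (hf.2.1.prime.dvd_or_dvd h).imp ?_ ?_ <;> intro h <;>
    exact eq_of_monic_of_associated hf.1 (monic_X_sub_C _)
      (hf.2.1.associated_of_dvd (irreducible_X_sub_C _) h)
  · rintro (rfl | rfl)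
    · exact dvd_mul_right _ _
    · exact dvd_mul_left _ _

theorem natDegree_eq_one_of_dvd_X_sq_sub_one {F : Type*} [Field F] {f : F[X]}
    (hf : f ∈ monicIrred F) (h : f ∣ X ^ 2 - 1) :
    f.natDegree = 1 := by
  rcases (dvd_X_sq_sub_one_iff_eq hf).1 h with rfl | rfl <;> exact natDegree_X_sub_C _

theorem natDegree_eq_sum_of_squarefree {F : Type*} [Field F] {g : F[X]} (hg : g.Monic)
    (hsq : Squarefree g)
    (T : Finset F[X]) (hT : ∀ f, f ∈ T ↔ f.Monic ∧ Irreducible f ∧ f ∣ g) :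
    g.natDegree = ∑ f ∈ T, f.natDegree := by
  classical
  have hnd := (UniqueFactorizationMonoid.squarefree_iff_nodup_normalizedFactors hg.ne_zero).1 hsq
  have hTe : T = (UniqueFactorizationMonoid.normalizedFactors g).toFinset := by
    ext f
    rw [hT, Multiset.mem_toFinset, Polynomial.mem_normalizedFactors_iff hg.ne_zero]
    tauto
  have hprod := UniqueFactorizationMonoid.prod_normalizedFactors_eq hg.ne_zero
  rw [hg.normalize_eq_self] at hprod
  conv_lhs => rw [← hprod]
  rw [natDegree_multiset_prod_of_monic, hTe, Finset.sum, Multiset.toFinset_val,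
    Multiset.dedup_eq_self.2 hnd]
  intro f hf
  exact ((Polynomial.mem_normalizedFactors_iff hg.ne_zero).1 hf).2.1

theorem root_ne_zero {F : Type*} [Field F] {f : F[X]} (hf : f ∈ monicIrred F) :
    AdjoinRoot.root f ≠ 0 := by
  intro h
  have h1 : aeval (AdjoinRoot.root f) (X : F[X]) = 0 := by rw [aeval_X, h]
  rw [aeval_root_eq_zero_iff] at h1
  exact hf.2.2 (X_dvd_iff.1 (hf.2.1.associated_of_dvd irreducible_X h1).symm.dvd)

variable {F : Type*} [Field F] [Fintype F] {f : F[X]}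

theorem finite_adjoinRoot (hf : f.Monic) : Finite (AdjoinRoot f) :=
  have := hf.finite_adjoinRoot
  Module.finite_of_finite F

theorem root_pow_eq_iff (hf : Irreducible f) (m : ℕ) :
    AdjoinRoot.root f ^ Fintype.card F ^ m = AdjoinRoot.root f ↔ f.natDegree ∣ m := by
  rw [hf.natDegree_dvd_iff_dvd_X_pow_card_pow_sub_X, ← aeval_root_eq_zero_iff, map_sub,
    map_pow, aeval_X, sub_eq_zero, Nat.card_eq_fintype_card]

theorem frobenius_pow_apply {L : Type*} [Field L] [Algebra F L] (j : ℕ) (x : L) :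
    (FiniteField.frobeniusAlgHom F L ^ j) x = x ^ Fintype.card F ^ j := by
  rw [AlgHom.coe_pow, FiniteField.coe_frobeniusAlgHom, pow_iterate]

/-- Self-duality says that a root is conjugate to its inverse, and over a finite field the
conjugates of a root are its images under powers of Frobenius. -/
theorem eq_dualPoly_iff_exists_pow (hf : f ∈ monicIrred F) :
    f = dualPoly f ↔ ∃ j, AdjoinRoot.root f ^ Fintype.card F ^ j * AdjoinRoot.root f = 1 := by
  have hfact : Fact (Irreducible f) := ⟨hf.2.1⟩
  have hfin := finite_adjoinRoot hf.1
  have h0 := root_ne_zero hf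
  have hroot : aeval (AdjoinRoot.root f) f = 0 := by rw [aeval_root_eq_zero_iff]
  rw [eq_dualPoly_iff hf h0 hroot]
  constructor
  · intro h
    let φ : AdjoinRoot f →ₐ[F] AdjoinRoot f :=
      AdjoinRoot.liftAlgHom f (Algebra.ofId F _) (AdjoinRoot.root f)⁻¹ h
    obtain ⟨j, hj⟩ := (FiniteField.bijective_frobeniusAlgHom_pow F (AdjoinRoot f)).2 φ
    refine ⟨j, ?_⟩
    have h1 : φ (AdjoinRoot.root f) = (AdjoinRoot.root f)⁻¹ := AdjoinRoot.liftAlgHom_root ..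
    rw [← hj, frobenius_pow_apply] at h1
    rw [h1, inv_mul_cancel₀ h0]
  · rintro ⟨j, hj⟩
    rw [← eq_inv_of_mul_eq_one_left hj, ← frobenius_pow_apply, aeval_algHom_apply, hroot, map_zero]

theorem root_pow_pow (m n : ℕ) : AdjoinRoot.root f ^ Fintype.card F ^ (m + n) =
    (AdjoinRoot.root f ^ Fintype.card F ^ m) ^ Fintype.card F ^ n := by
  rw [pow_add, pow_mul]

/-- Applying the `j`-th power of Frobenius twice, when it inverts the root. -/
theorem root_pow_two_mul {j : ℕ}
    (hf : f ∈ monicIrred F)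
    (hj : AdjoinRoot.root f ^ Fintype.card F ^ j * AdjoinRoot.root f = 1) :
    f.natDegree ∣ 2 * j := by
  have hfact : Fact (Irreducible f) := ⟨hf.2.1⟩
  have h1 := eq_inv_of_mul_eq_one_left hj
  rw [← root_pow_eq_iff hf.2.1, two_mul, root_pow_pow, h1, inv_pow, h1, inv_inv]

/-- Here the `j`-th power of Frobenius both fixes and inverts the root. -/
theorem root_sq_eq_one_of_dvd {j : ℕ} (hf : f ∈ monicIrred F)
    (hj : AdjoinRoot.root f ^ Fintype.card F ^ j * AdjoinRoot.root f = 1)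
    (hd : f.natDegree ∣ j) : f ∣ X ^ 2 - 1 := by
  rw [dvd_X_sq_sub_one_iff]
  rwa [(root_pow_eq_iff hf.2.1 j).2 hd] at hj

theorem selfDual_of_dvd_X_sq_sub_one (hf : f ∈ monicIrred F) (h : f ∣ X ^ 2 - 1) :
    f = dualPoly f := by
  rw [eq_dualPoly_iff_exists_pow hf]
  refine ⟨0, ?_⟩
  rw [pow_zero, pow_one]
  exact (dvd_X_sq_sub_one_iff).1 h

theorem dvd_X_sq_sub_one_of_odd (hf : f ∈ monicIrred F) (h : f = dualPoly f)
    (ho : Odd f.natDegree) : f ∣ X ^ 2 - 1 := by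
  obtain ⟨j, hj⟩ := (eq_dualPoly_iff_exists_pow hf).1 h
  exact root_sq_eq_one_of_dvd hf hj
    ((Nat.Coprime.dvd_mul_left ho.coprime_two_right).1 (root_pow_two_mul hf hj))

theorem dvd_X_pow_sub_one_iff_root (k : ℕ) : f ∣ X ^ (Fintype.card F ^ k + 1) - 1 ↔
    AdjoinRoot.root f ^ Fintype.card F ^ k * AdjoinRoot.root f = 1 := by
  rw [← aeval_root_eq_zero_iff, map_sub, map_pow, aeval_X, map_one, sub_eq_zero, pow_succ]

theorem root_pow_eq_of_modEq {m n : ℕ} (hf : Irreducible f) (h : f.natDegree ∣ n) :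
    AdjoinRoot.root f ^ Fintype.card F ^ (m + n) = AdjoinRoot.root f ^ Fintype.card F ^ m := by
  rw [add_comm, root_pow_pow, (root_pow_eq_iff hf n).2 h]

/-- The irreducible factors of `X ^ (q ^ k + 1) - 1` are those of `X ^ 2 - 1` and the self-dual
polynomials of even degree `2 * d` with `k / d` an odd integer. -/
theorem dvd_X_pow_card_pow_add_one_sub_one_iff (hf : f ∈ monicIrred F) (k : ℕ) :
    f ∣ X ^ (Fintype.card F ^ k + 1) - 1 ↔
      f ∣ X ^ 2 - 1 ∨ ∃ d, d ∣ k ∧ Odd (k / d) ∧ f = dualPoly f ∧ f.natDegree = 2 * d := by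
  have hpos : 0 < f.natDegree := hf.2.1.natDegree_pos
  rw [dvd_X_pow_sub_one_iff_root]
  constructor
  · intro h
    have hdual := (eq_dualPoly_iff_exists_pow hf).2 ⟨k, h⟩
    by_cases h1 : f ∣ X ^ 2 - 1
    · exact Or.inl h1
    have h2 := root_pow_two_mul hf h
    rcases Nat.even_or_odd' f.natDegree with ⟨d, hd | hd⟩
    · have hdk : d ∣ k := by
        rw [hd] at h2
        exact Nat.dvd_of_mul_dvd_mul_left two_pos h2
      refine Or.inr ⟨d, hdk, ?_, hdual, hd⟩
      -- If `k / d` were even, the degree `2 * d` would divide `k`, and the root would equal its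
      -- inverse.
      rw [← Nat.not_even_iff_odd]
      rintro ⟨m, hm⟩
      refine h1 (root_sq_eq_one_of_dvd hf h ⟨m, ?_⟩)
      have := Nat.div_mul_cancel hdk
      rw [hm] at this
      rw [hd, ← this]
      ring
    · exact absurd (dvd_X_sq_sub_one_of_odd hf hdual ⟨d, hd⟩) h1
  · rintro (h | ⟨d, ⟨m, rfl⟩, hodd, hdual, hd⟩)
    · have h1 := natDegree_eq_one_of_dvd_X_sq_sub_one hf h
      rw [(root_pow_eq_iff hf.2.1 k).2 (h1 ▸ one_dvd k)]
      exact (dvd_X_sq_sub_one_iff).1 h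
    · have hd0 : 0 < d := by omega
      rw [Nat.mul_div_cancel_left m hd0] at hodd
      obtain ⟨j, hj⟩ := (eq_dualPoly_iff_exists_pow hf).1 hdual
      have h2 := root_pow_two_mul hf hj
      rw [hd] at h2
      obtain ⟨l, rfl⟩ := Nat.dvd_of_mul_dvd_mul_left two_pos h2
      have hl : Odd l := by
        rw [← Nat.not_even_iff_odd]
        rintro ⟨s, rfl⟩
        have := natDegree_eq_one_of_dvd_X_sq_sub_one hf
          (root_sq_eq_one_of_dvd hf hj ⟨s, by rw [hd]; ring⟩)
        omega
      obtain ⟨s, rfl⟩ := hl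
      obtain ⟨t, rfl⟩ := hodd
      -- Frobenius has period `2 * d` on the root, and all odd multiples of `d` agree modulo `2 *
      -- d`.
      have e : ∀ s, AdjoinRoot.root f ^ Fintype.card F ^ (d * (2 * s + 1)) =
          AdjoinRoot.root f ^ Fintype.card F ^ d := fun s => by
        rw [show d * (2 * s + 1) = d + 2 * d * s by ring]
        exact root_pow_eq_of_modEq hf.2.1 ⟨s, by rw [hd]⟩
      rw [e] at hj ⊢
      exact hj

end Frobenius

section Count

variable (F : Type*) [Field F] [Fintype F]

/-- The self-dual monic irreducible polynomials of degree `n`. -/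
def selfDualSet (n : ℕ) : Set F[X] := {f | f ∈ monicIrred F ∧ f = dualPoly f ∧ f.natDegree = n}

theorem finite_setOf_natDegree_eq (n : ℕ) : {f : F[X] | f.natDegree = n}.Finite := by
  refine Set.Finite.of_finite_image (f := fun f (i : Fin (n + 1)) => f.coeff i) (Set.toFinite _) ?_
  intro f hf g hg h
  ext i
  by_cases hi : i < n + 1
  · exact congrFun h ⟨i, hi⟩
  · rw [coeff_eq_zero_of_natDegree_lt, coeff_eq_zero_of_natDegree_lt]
    · exact (show g.natDegree = n from hg) ▸ by omega
    · exact (show f.natDegree = n from hf) ▸ by omega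

theorem finite_selfDualSet (n : ℕ) : (selfDualSet F n).Finite :=
  (finite_setOf_natDegree_eq F n).subset fun _ h => h.2.2

theorem ncard_selfDualSet (n : ℕ) :
    numSelfDual F n = (finite_selfDualSet F n).toFinset.card :=
  Set.ncard_eq_toFinset_card _ (finite_selfDualSet F n)

theorem mem_selfDualSet_one {f : F[X]} :
    f ∈ selfDualSet F 1 ↔ f = X - C 1 ∨ f = X - C (-1) := by
  constructor
  · rintro ⟨hf, h, h1⟩
    exact (dvd_X_sq_sub_one_iff_eq hf).1 (dvd_X_sq_sub_one_of_odd hf h (h1 ▸ odd_one))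
  · intro h
    have hf : f ∈ monicIrred F := by
      rcases h with rfl | rfl
      · exact ⟨monic_X_sub_C _, irreducible_X_sub_C _, by simp⟩
      · exact ⟨monic_X_sub_C _, irreducible_X_sub_C _, by simp⟩
    have h' := (dvd_X_sq_sub_one_iff_eq hf).2 h
    exact ⟨hf, selfDual_of_dvd_X_sq_sub_one hf h', natDegree_eq_one_of_dvd_X_sq_sub_one hf h'⟩

theorem numSelfDual_one : numSelfDual F 1 = eNum (Fintype.card F) := by
  have e : {f : F[X] | f ∈ monicIrred F ∧ f = dualPoly f ∧ f.natDegree = 1} =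
      {X - C 1, X - C (-1)} := by
    ext f
    exact mem_selfDualSet_one F
  rw [numSelfDual, e, eNum]
  split_ifs with h
  · have h2 : ringChar F = 2 := FiniteField.even_card_iff_char_two.2 (Nat.even_iff.1 h)
    have : CharP F 2 := h2 ▸ ringChar.charP F
    rw [CharTwo.neg_eq, Set.pair_eq_singleton, Set.ncard_singleton]
  · refine Set.ncard_pair fun heq => h ?_
    rw [Nat.even_iff, ← FiniteField.even_card_iff_char_two]
    by_contra hc
    exact Ring.neg_one_ne_one_of_char_ne_two hc (C_injective (sub_right_injective heq)).symm

theorem numSelfDual_of_odd {n : ℕ} (hn : Odd n) (h1 : n ≠ 1) : numSelfDual F n = 0 := by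
  refine (Set.ncard_eq_zero (finite_selfDualSet F n)).2 ?_
  refine Set.eq_empty_iff_forall_notMem.2 fun f hf => h1 ?_
  obtain ⟨hf1, hf2, rfl⟩ := hf
  exact natDegree_eq_one_of_dvd_X_sq_sub_one hf1 (dvd_X_sq_sub_one_of_odd hf1 hf2 hn)

theorem card_pow_ne_zero_cast {k : ℕ} (hk : k ≠ 0) : ((Fintype.card F ^ k : ℕ) : F) = 0 := by
  rw [Nat.cast_pow, FiniteField.cast_card_eq_zero, zero_pow hk]

/-- Degree count for `X^(q^k+1) - 1`, which is squarefree because `q^k + 1` is `1` in `F`. Its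
factors `X - 1` and `X + 1`, which coincide in characteristic two, account for `e`. -/
theorem sum_odd_quotient_mul_numSelfDual {k : ℕ} (hk : k ≠ 0) :
    2 * ∑ d ∈ k.divisors with Odd (k / d), d * numSelfDual F (2 * d) + eNum (Fintype.card F) =
      Fintype.card F ^ k + 1 := by
  classical
  have hcast : ((Fintype.card F ^ k + 1 : ℕ) : F) ≠ 0 := by
    rw [Nat.cast_add, card_pow_ne_zero_cast F hk, zero_add, Nat.cast_one]
    exact one_ne_zero
  have hm : (X ^ (Fintype.card F ^ k + 1) - C (1 : F)).Monic := monic_X_pow_sub_C _ (Nat.succ_ne_zero _)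
  have hsq := (separable_X_pow_sub_C (1 : F) hcast one_ne_zero).squarefree
  have hmem0 : ∀ f : F[X], f.Monic → Irreducible f → f ∣ X ^ (Fintype.card F ^ k + 1) - C (1 : F) →
      f ∈ monicIrred F := by
    refine fun f h1 h2 h3 => ⟨h1, h2, fun h0 => ?_⟩
    have h4 := (X_dvd_iff.2 h0).trans h3
    rw [X_dvd_iff] at h4
    simp [coeff_X_pow] at h4
  have key := natDegree_eq_sum_of_squarefree hm hsq
    ((finite_selfDualSet F 1).toFinset ∪ (k.divisors.filter fun d => Odd (k / d)).biUnion fun d =>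
      (finite_selfDualSet F (2 * d)).toFinset) (by
    intro f
    simp only [Finset.mem_union, Finset.mem_biUnion, Finset.mem_filter, Nat.mem_divisors,
      Set.Finite.mem_toFinset]
    constructor
    · intro h
      have hf : f ∈ monicIrred F := by
        rcases h with h | ⟨d, -, h⟩
        · exact h.1
        · exact h.1
      refine ⟨hf.1, hf.2.1, ?_⟩
      rw [C_1, dvd_X_pow_card_pow_add_one_sub_one_iff hf]
      refine h.imp (fun h => (dvd_X_sq_sub_one_iff_eq hf).2 ((mem_selfDualSet_one F).1 h)) ?_
      rintro ⟨d, ⟨h1, h2⟩, h3⟩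
      exact ⟨d, h1.1, h2, h3.2⟩
    · rintro ⟨h1, h2, h3⟩
      have hf := hmem0 f h1 h2 h3
      rw [C_1, dvd_X_pow_card_pow_add_one_sub_one_iff hf] at h3
      refine h3.imp (fun h => (mem_selfDualSet_one F).2 ((dvd_X_sq_sub_one_iff_eq hf).1 h)) ?_
      rintro ⟨d, h1, h2, h3⟩
      exact ⟨d, ⟨⟨h1, hk⟩, h2⟩, hf, h3⟩)
  rw [natDegree_X_pow_sub_C, Finset.sum_union, Finset.sum_biUnion] at key
  · rw [key, add_comm, Finset.mul_sum]
    congr 1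
    · rw [Finset.sum_congr rfl fun f hf => ((Set.Finite.mem_toFinset _).1 hf).2.2, Finset.sum_const,
        ← ncard_selfDualSet, numSelfDual_one, smul_eq_mul, mul_one]
    · refine Finset.sum_congr rfl fun d _ => ?_
      rw [Finset.sum_congr rfl fun f hf => ((Set.Finite.mem_toFinset _).1 hf).2.2, Finset.sum_const,
        ← ncard_selfDualSet, smul_eq_mul]
      ring
  · intro d _ d' _ hdd
    refine Finset.disjoint_left.2 fun f h1 h2 => hdd ?_
    have h3 := ((Set.Finite.mem_toFinset _).1 h1).2.2
    have h4 := ((Set.Finite.mem_toFinset _).1 h2).2.2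
    omega
  · refine Finset.disjoint_left.2 fun f h1 h2 => ?_
    obtain ⟨d, -, h2⟩ := Finset.mem_biUnion.1 h2
    have h3 := ((Set.Finite.mem_toFinset _).1 h1).2.2
    have h4 := ((Set.Finite.mem_toFinset _).1 h2).2.2
    omega

/-- The monic irreducible polynomials of degree `n` with nonzero constant term. -/
def monicIrredSet (n : ℕ) : Set F[X] := {f | f ∈ monicIrred F ∧ f.natDegree = n}

theorem finite_monicIrredSet (n : ℕ) : (monicIrredSet F n).Finite :=
  (finite_setOf_natDegree_eq F n).subset fun _ h => h.2

/-- The map `g ↦ {g, g^*}` has fibres of exactly two elements, as duality is an involution without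
fixed points on this set. -/
theorem card_nonSelfDual (n : ℕ) :
    {f : F[X] | f ∈ monicIrred F ∧ f ≠ dualPoly f ∧ f.natDegree = n}.ncard =
      2 * numDualPairs F n := by
  classical
  set S := {f : F[X] | f ∈ monicIrred F ∧ f ≠ dualPoly f ∧ f.natDegree = n} with hS
  have hfin : S.Finite := (finite_setOf_natDegree_eq F n).subset fun _ h => h.2.2
  have himg : {p : Sym2 F[X] | ∃ g : F[X], g ∈ monicIrred F ∧ g ≠ dualPoly g ∧ g.natDegree = n ∧
      p = s(g, dualPoly g)} = (hfin.toFinset.image fun g => s(g, dualPoly g) : Finset _) := by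
    ext p
    simp only [Finset.coe_image, Set.Finite.coe_toFinset, Set.mem_image, Set.mem_ofPred_eq, hS]
    constructor
    · rintro ⟨g, h1, h2, h3, h4⟩
      exact ⟨g, ⟨h1, h2, h3⟩, h4.symm⟩
    · rintro ⟨g, ⟨h1, h2, h3⟩, h4⟩
      exact ⟨g, h1, h2, h3, h4.symm⟩
  rw [numDualPairs, himg, Set.ncard_coe_finset, Set.ncard_eq_toFinset_card _ hfin, mul_comm]
  rw [Finset.card_eq_sum_card_image fun g => s(g, dualPoly g)]
  refine Finset.sum_const_nat fun p hp => ?_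
  obtain ⟨g, hg, rfl⟩ := Finset.mem_image.1 hp
  obtain ⟨hg1, hg2, hg3⟩ := hfin.mem_toFinset.1 hg
  have hdd := dualPoly_dualPoly hg1.1 hg1.2.2
  rw [← Finset.card_pair hg2]
  congr 1
  ext f
  simp only [Finset.mem_filter, Set.Finite.mem_toFinset, Finset.mem_insert,
    Finset.mem_singleton, Sym2.eq_iff]
  constructor
  · rintro ⟨-, h | h⟩
    · exact Or.inl h.1
    · exact Or.inr h.1
  · rintro (rfl | rfl)
    · exact ⟨⟨hg1, hg2, hg3⟩, Or.inl ⟨rfl, rfl⟩⟩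
    · refine ⟨⟨dualPoly_mem_monicIrred hg1, ?_, ?_⟩, Or.inr ⟨rfl, hdd⟩⟩
      · rw [hdd]
        exact hg2.symm
      · rw [natDegree_dualPoly hg1.2.2, hg3]

theorem card_monicIrredSet (n : ℕ) :
    (finite_monicIrredSet F n).toFinset.card = numSelfDual F n + 2 * numDualPairs F n := by
  rw [← Set.ncard_eq_toFinset_card _ (finite_monicIrredSet F n), ← card_nonSelfDual, numSelfDual]
  refine Eq.trans ?_ (Set.ncard_union_eq ?_ (finite_selfDualSet F n)
      ((finite_setOf_natDegree_eq F n).subset fun _ h => h.2.2))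
  · congr 1
    ext f
    simp only [monicIrredSet, Set.mem_union, Set.mem_ofPred_eq]
    tauto
  · exact Set.disjoint_left.2 fun f h1 h2 => h2.2.1 h1.2.1

/-- Degree count for the separable polynomial `X^(q^k) - X`. The `+ 1` is the factor `X`, the only
one with zero constant term. -/
theorem sum_divisors_mul_card_monicIrredSet {k : ℕ} (hk : k ≠ 0) :
    ∑ n ∈ k.divisors, n * (numSelfDual F n + 2 * numDualPairs F n) + 1 = Fintype.card F ^ k := by
  classical
  have hcard : 1 < Fintype.card F := Fintype.one_lt_card
  have hsep : (X ^ Fintype.card F ^ k - X : F[X]).Separable := by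
    obtain ⟨p, hp⟩ := CharP.exists F
    refine galois_poly_separable p _ ?_
    rw [← CharP.cast_eq_zero_iff F, card_pow_ne_zero_cast F hk]
  have hdeg := FiniteField.X_pow_card_pow_sub_X_natDegree_eq F hk hcard
  have hm : (X ^ Fintype.card F ^ k - X : F[X]).Monic := by
    refine monic_X_pow_sub ?_
    rw [degree_X]
    exact_mod_cast Nat.one_lt_pow hk hcard
  have key := natDegree_eq_sum_of_squarefree hm hsep.squarefree
    (insert X (k.divisors.biUnion fun n => (finite_monicIrredSet F n).toFinset)) (by
    intro f
    simp only [Finset.mem_insert, Finset.mem_biUnion, Nat.mem_divisors, Set.Finite.mem_toFinset]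
    constructor
    · rintro (rfl | ⟨n, ⟨h1, -⟩, hf, rfl⟩)
      · exact ⟨monic_X, irreducible_X, dvd_sub (dvd_pow_self _ (by positivity)) dvd_rfl⟩
      · refine ⟨hf.1, hf.2.1, ?_⟩
        rw [← Nat.card_eq_fintype_card]
        exact hf.2.1.natDegree_dvd_iff_dvd_X_pow_card_pow_sub_X.1 h1
    · rintro ⟨h1, h2, h3⟩
      by_cases h0 : f.coeff 0 = 0
      · left
        exact (eq_of_monic_of_associated monic_X h1
          (irreducible_X.associated_of_dvd h2 (X_dvd_iff.2 h0))).symm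
      · rw [← Nat.card_eq_fintype_card, ← h2.natDegree_dvd_iff_dvd_X_pow_card_pow_sub_X] at h3
        exact Or.inr ⟨_, ⟨h3, hk⟩, ⟨h1, h2, h0⟩, rfl⟩)
  rw [hdeg, Finset.sum_insert, Finset.sum_biUnion, natDegree_X] at key
  · rw [key, add_comm]
    congr 1
    refine Finset.sum_congr rfl fun n _ => ?_
    rw [Finset.sum_congr rfl fun f hf => ((Set.Finite.mem_toFinset _).1 hf).2, Finset.sum_const,
      ← card_monicIrredSet, smul_eq_mul, mul_comm]
  · intro d _ d' _ hdd
    refine Finset.disjoint_left.2 fun f h1 h2 => hdd ?_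
    exact ((Set.Finite.mem_toFinset _).1 h1).2.symm.trans ((Set.Finite.mem_toFinset _).1 h2).2
  · intro h
    obtain ⟨n, -, h⟩ := Finset.mem_biUnion.1 h
    exact ((Set.Finite.mem_toFinset _).1 h).1.2.2 coeff_X_zero

/-- The preceding count with the self-dual polynomials split by parity of degree. An even degree `2
* d` divides `k` exactly if `d` divides `k` with even quotient; among the odd degrees only `1`
occurs and contributes `e`. -/
theorem sum_even_quotient_mul_numSelfDual {k : ℕ} (hk : k ≠ 0) :
    2 * ∑ d ∈ k.divisors with Even (k / d), d * numSelfDual F (2 * d) +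
      2 * ∑ d ∈ k.divisors, d * numDualPairs F d + eNum (Fintype.card F) + 1 =
      Fintype.card F ^ k := by
  classical
  rw [← sum_divisors_mul_card_monicIrredSet F hk]
  have e1 : ∑ n ∈ k.divisors, n * numSelfDual F n =
      2 * ∑ d ∈ k.divisors with Even (k / d), d * numSelfDual F (2 * d) +
        eNum (Fintype.card F) := by
    rw [← Finset.sum_filter_add_sum_filter_not _ (fun n => Even n)]
    congr 1
    · rw [Finset.mul_sum]
      symm
      refine Finset.sum_bij' (fun d _ => 2 * d) (fun n _ => n / 2) ?_ ?_ ?_ ?_ ?_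
      · intro d hd
        simp only [Finset.mem_filter, Nat.mem_divisors] at hd ⊢
        obtain ⟨⟨⟨m, rfl⟩, h0⟩, h⟩ := hd
        have hd0 : 0 < d := Nat.pos_of_ne_zero (left_ne_zero_of_mul h0)
        rw [Nat.mul_div_cancel_left m hd0] at h
        obtain ⟨r, rfl⟩ := h
        exact ⟨⟨⟨r, by ring⟩, h0⟩, even_two_mul d⟩
      · intro n hn
        simp only [Finset.mem_filter, Nat.mem_divisors] at hn ⊢
        obtain ⟨⟨⟨m, rfl⟩, h0⟩, ⟨r, rfl⟩⟩ := hn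
        have hr : 0 < r := by
          rcases Nat.eq_zero_or_pos r with rfl | h
          · simp at h0
          · exact h
        rw [show (r + r) / 2 = r by omega, show (r + r) * m = r * (m + m) by ring,
          Nat.mul_div_cancel_left _ hr]
        exact ⟨⟨dvd_mul_right _ _, by rwa [show r * (m + m) = (r + r) * m by ring]⟩, ⟨m, rfl⟩⟩
      · intro d _
        simp
      · intro n hn
        obtain ⟨r, rfl⟩ := (Finset.mem_filter.1 hn).2
        omega
      · intro d _
        ring
    · rw [Finset.sum_eq_single 1]
      · rw [one_mul, numSelfDual_one]
      · intro n hn h1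
        rw [numSelfDual_of_odd F (Nat.not_even_iff_odd.1 (Finset.mem_filter.1 hn).2) h1, mul_zero]
      · intro h
        exact absurd (Finset.mem_filter.2 ⟨Nat.one_mem_divisors.2 hk, Nat.not_even_one⟩) h
  simp only [mul_add, Finset.sum_add_distrib]
  rw [e1, Finset.mul_sum (f := fun d => d * numDualPairs F d)]
  simp only [mul_left_comm 2]
  ring

end Count

end CharDegree
end

/-! ### Convergence of infinite products of power series. -/

noncomputable section

namespace CharDegree
open PowerSeries Filter Topology

section Multipliable

variable {ι κ : Type*}

/-- The sum of the absolute values of the first `m + 1` coefficients. -/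
def truncNorm (m : ℕ) (f : ℝ⟦X⟧) : ℝ := ∑ k ∈ Finset.range (m + 1), |coeff k f|

theorem truncNorm_nonneg (m : ℕ) (f : ℝ⟦X⟧) : 0 ≤ truncNorm m f :=
  Finset.sum_nonneg fun _ _ => abs_nonneg _

theorem abs_coeff_le_truncNorm (m : ℕ) (f : ℝ⟦X⟧) : |coeff m f| ≤ truncNorm m f :=
  Finset.single_le_sum (f := fun k => |coeff k f|) (fun _ _ => abs_nonneg _)
    (Finset.self_mem_range_succ m)

theorem truncNorm_one (m : ℕ) : truncNorm m 1 = 1 := by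
  rw [truncNorm, Finset.sum_eq_single 0]
  · simp
  · intro k _ hk
    rw [coeff_one, if_neg hk, abs_zero]
  · simp

theorem truncNorm_mul_le (m : ℕ) (f g : ℝ⟦X⟧) :
    truncNorm m (f * g) ≤ truncNorm m f * truncNorm m g := by
  calc truncNorm m (f * g) ≤ ∑ k ∈ Finset.range (m + 1), ∑ p ∈ Finset.HasAntidiagonal.antidiagonal k,
        |coeff p.1 f| * |coeff p.2 g| := by
        refine Finset.sum_le_sum fun k _ => ?_
        rw [coeff_mul]
        refine (Finset.abs_sum_le_sum_abs _ _).trans (Finset.sum_le_sum fun p _ => ?_)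
        rw [abs_mul]
    _ = ∑ p ∈ (Finset.range (m + 1)).biUnion Finset.HasAntidiagonal.antidiagonal,
        |coeff p.1 f| * |coeff p.2 g| := by
        refine (Finset.sum_biUnion fun a _ b _ hab => ?_).symm
        refine Finset.disjoint_left.2 fun p h1 h2 => hab ?_
        rw [Finset.HasAntidiagonal.mem_antidiagonal] at h1 h2
        omega
    _ ≤ ∑ p ∈ Finset.range (m + 1) ×ˢ Finset.range (m + 1), |coeff p.1 f| * |coeff p.2 g| := by
        refine Finset.sum_le_sum_of_subset_of_nonneg (fun p hp => ?_)
          fun _ _ _ => mul_nonneg (abs_nonneg _) (abs_nonneg _)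
        simp only [Finset.mem_biUnion, Finset.mem_range, Finset.HasAntidiagonal.mem_antidiagonal,
          Finset.mem_product] at hp ⊢
        obtain ⟨a, h1, h2⟩ := hp
        omega
    _ = _ := by rw [truncNorm, truncNorm, Finset.sum_mul_sum, Finset.sum_product]

theorem truncNorm_prod_le (m : ℕ) (f : ι → ℝ⟦X⟧) (s : Finset ι) :
    truncNorm m (∏ i ∈ s, f i) ≤ ∏ i ∈ s, truncNorm m (f i) := by
  classical
  induction s using Finset.induction_on with
  | empty => rw [Finset.prod_empty, Finset.prod_empty, truncNorm_one]
  | insert a s ha ih =>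
    rw [Finset.prod_insert ha, Finset.prod_insert ha]
    exact (truncNorm_mul_le m _ _).trans (mul_le_mul_of_nonneg_left ih (truncNorm_nonneg m _))

/-- The coefficients of `f i - 1` are absolutely summable over `i`. -/
def NearOne (f : ι → ℝ⟦X⟧) : Prop := ∀ m, Summable fun i => coeff m (f i - 1)

/-- Expanding `∏ (1 + g_i)` gives a sum over finite sets. As `truncNorm m` is submultiplicative,
this sum is dominated by the expansion of `∏ (1 + truncNorm m g_i)`, which converges. -/
theorem NearOne.multipliable {f : ι → ℝ⟦X⟧} (hf : NearOne f) : Multipliable f := by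
  have h : Summable fun s : Finset ι => ∏ i ∈ s, (f i - 1) := by
    refine (WithPiTopology.summable_iff_summable_coeff ℝ).2 fun m => ?_
    refine Summable.of_abs (Summable.of_nonneg_of_le (fun _ => abs_nonneg _)
      (fun s => (abs_coeff_le_truncNorm m _).trans (truncNorm_prod_le m _ s))
      (summable_finsetProd_of_summable_nonneg (fun i => truncNorm_nonneg m _) ?_))
    exact summable_sum fun k _ => (hf k).abs
  simpa using multipliable_one_add_of_summable_prod h

theorem NearOne.comp_injective {f : ι → ℝ⟦X⟧} (hf : NearOne f) {e : κ → ι}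
    (he : Function.Injective e) : NearOne fun k => f (e k) :=
  fun m => (hf m).comp_injective he

/-- The coefficient of `X ^ m` receives contributions only from `d ≤ m`, so summability over pairs
reduces to finitely many rows. -/
theorem nearOne_uncurry {f : ℕ+ → ι → ℝ⟦X⟧} (hf : ∀ d, NearOne (f d))
    (h : ∀ (d : ℕ+) i, X ^ (d : ℕ) ∣ f d i - 1) : NearOne (Function.uncurry f) := by
  intro m
  refine Summable.of_abs ((summable_prod_of_nonneg fun _ => abs_nonneg _).2
    ⟨fun d => (hf d m).abs, ?_⟩)
  refine summable_of_hasFiniteSupport ((Set.finite_Iic (⟨m + 1, m.succ_pos⟩ : ℕ+)).subset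
    fun d hd => ?_)
  by_contra hc
  refine hd ?_
  have hlt : m < (d : ℕ) := by
    have : (⟨m + 1, m.succ_pos⟩ : ℕ+) < d := not_le.1 hc
    have : m + 1 < (d : ℕ) := this
    omega
  change ∑' i, |coeff m (f d i - 1)| = 0
  simp only [X_pow_dvd_iff.1 (h d _) m hlt, abs_zero, tsum_zero]

theorem nearOne_of_X_pow_dvd {f : ℕ+ → ℝ⟦X⟧} (h : ∀ d : ℕ+, X ^ (d : ℕ) ∣ f d - 1) : NearOne f := by
  have h1 : NearOne (Function.uncurry fun (d : ℕ+) (_ : Unit) => f d) :=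
    nearOne_uncurry (fun d m => summable_of_hasFiniteSupport (Set.toFinite _)) fun d _ => h d
  exact h1.comp_injective (e := fun d => (d, ())) fun a b hab => (Prod.ext_iff.1 hab).1

/-- The substitution `X ↦ c * X ^ s`. -/
def dilate (c : ℝ) (s : ℕ+) : ℝ⟦X⟧ →+* ℝ⟦X⟧ :=
  (expand (s : ℕ) s.ne_zero : ℝ⟦X⟧ →ₐ[ℝ] ℝ⟦X⟧).toRingHom.comp (rescale c)

theorem coeff_dilate (c : ℝ) (s : ℕ+) (f : ℝ⟦X⟧) (m : ℕ) :
    coeff m (dilate c s f) = if (s : ℕ) ∣ m then c ^ (m / s) * coeff (m / s) f else 0 := by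
  change coeff m (expand (s : ℕ) s.ne_zero (rescale c f)) = _
  rw [coeff_expand]
  simp only [coeff_rescale]

theorem dilate_X (c : ℝ) (s : ℕ+) : dilate c s X = C c * X ^ (s : ℕ) := by
  change expand (s : ℕ) s.ne_zero (rescale c X) = _
  rw [rescale_X, map_mul, expand_C, expand_X]

theorem dilate_C (c : ℝ) (s : ℕ+) (a : ℝ) : dilate c s (C a) = C a := by
  change expand (s : ℕ) s.ne_zero (rescale c (C a)) = _
  rw [show rescale c (C a) = C a by ext n; rw [coeff_rescale, coeff_C]; split_ifs <;> simp [*],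
    expand_C]

theorem continuous_dilate (c : ℝ) (s : ℕ+) : Continuous (dilate c s) := by
  refine continuous_iff_continuousAt.2 fun f => ?_
  refine (WithPiTopology.tendsto_iff_coeff_tendsto ℝ _ _ _).2 fun m => ?_
  simp only [coeff_dilate]
  split_ifs
  · exact ((WithPiTopology.continuous_coeff ℝ _).tendsto f).const_mul _
  · exact tendsto_const_nhds

/-- A coefficient in positive degree `m` is zero or `c ^ k` times a coefficient of index `k` with `1
≤ k ≤ m`; then `|c| ^ k ≤ |c|`, which is summable over `i`. -/
theorem nearOne_dilate {c : ι → ℝ} (hc : Summable c) (h1 : ∀ i, |c i| ≤ 1) (s : ι → ℕ+)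
    {f : ι → ℝ⟦X⟧} (h0 : ∀ i, constantCoeff (f i) = 1) (hf : ∀ m, ∃ B, ∀ i, |coeff m (f i)| ≤ B) :
    NearOne fun i => dilate (c i) (s i) (f i) := by
  intro m
  choose B hB using hf
  refine Summable.of_abs (Summable.of_nonneg_of_le (fun _ => abs_nonneg _) (fun i => ?_)
    (hc.abs.mul_right (∑ k ∈ Finset.range (m + 1), |B k|)))
  have hnn : 0 ≤ |c i| * ∑ k ∈ Finset.range (m + 1), |B k| :=
    mul_nonneg (abs_nonneg _) (Finset.sum_nonneg fun _ _ => abs_nonneg _)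
  rw [map_sub, coeff_dilate]
  rcases Nat.eq_zero_or_pos m with rfl | hm
  · simpa [h0] using hnn
  rw [coeff_one, if_neg hm.ne', sub_zero]
  split_ifs with hd
  · obtain ⟨k, rfl⟩ := hd
    have hk : k ≠ 0 := right_ne_zero_of_mul hm.ne'
    rw [Nat.mul_div_cancel_left _ (s i).pos, abs_mul, abs_pow]
    refine mul_le_mul ?_ ?_ (abs_nonneg _) (abs_nonneg _)
    · exact pow_le_of_le_one (abs_nonneg _) (h1 i) hk
    · refine ((hB k i).trans (le_abs_self _)).trans
        (Finset.single_le_sum (f := fun k => |B k|) (fun _ _ => abs_nonneg _) ?_)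
      rw [Finset.mem_range]
      exact Nat.lt_succ_of_le (Nat.le_mul_of_pos_left _ (s i).pos)
  · simpa using hnn

theorem nearOne_dilate_const {c : ι → ℝ} (hc : Summable c) (h1 : ∀ i, |c i| ≤ 1) (s : ι → ℕ+)
    {f : ℝ⟦X⟧} (h0 : constantCoeff f = 1) : NearOne fun i => dilate (c i) (s i) f :=
  nearOne_dilate hc h1 s (fun _ => h0) fun _ => ⟨_, fun _ => le_rfl⟩

end Multipliable

/-! ### Logarithmic derivatives. -/

section LogDeriv

/-- `ℓ` is the logarithmic derivative of `f` with respect to `X * d/dX`. -/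
def HasLogDeriv (f ℓ : ℝ⟦X⟧) : Prop := X * d⁄dX ℝ f = f * ℓ

theorem hasLogDeriv_one : HasLogDeriv 1 0 := by
  rw [HasLogDeriv, derivative_one, mul_zero, mul_zero]

theorem HasLogDeriv.mul {f g ℓ m : ℝ⟦X⟧} (hf : HasLogDeriv f ℓ) (hg : HasLogDeriv g m) :
    HasLogDeriv (f * g) (ℓ + m) := by
  rw [HasLogDeriv] at *
  rw [Derivation.leibniz, smul_eq_mul, smul_eq_mul]
  linear_combination g * hf + f * hg

theorem HasLogDeriv.pow {f ℓ : ℝ⟦X⟧} (hf : HasLogDeriv f ℓ) (n : ℕ) :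
    HasLogDeriv (f ^ n) (n * ℓ) := by
  induction n with
  | zero =>
    rw [pow_zero, Nat.cast_zero, zero_mul]
    exact hasLogDeriv_one
  | succ n ih =>
    rw [pow_succ, Nat.cast_succ, add_mul, one_mul]
    exact ih.mul hf

theorem HasLogDeriv.prod {ι : Type*} {f ℓ : ι → ℝ⟦X⟧} (h : ∀ i, HasLogDeriv (f i) (ℓ i))
    (s : Finset ι) : HasLogDeriv (∏ i ∈ s, f i) (∑ i ∈ s, ℓ i) := by
  classical
  induction s using Finset.induction_on with
  | empty => exact hasLogDeriv_one
  | insert a s ha ih =>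
    rw [Finset.prod_insert ha, Finset.sum_insert ha]
    exact (h a).mul ih

theorem continuous_derivative : Continuous (d⁄dX ℝ : ℝ⟦X⟧ → ℝ⟦X⟧) := by
  refine continuous_iff_continuousAt.2 fun f => ?_
  refine (WithPiTopology.tendsto_iff_coeff_tendsto ℝ _ _ _).2 fun m => ?_
  simp only [coeff_derivative]
  exact ((WithPiTopology.continuous_coeff ℝ _).tendsto f).mul_const _

theorem HasLogDeriv.of_hasProd {ι : Type*} {f ℓ : ι → ℝ⟦X⟧} {g m : ℝ⟦X⟧} (hg : HasProd f g)
    (hm : HasSum ℓ m) (h : ∀ i, HasLogDeriv (f i) (ℓ i)) : HasLogDeriv g m := by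
  refine tendsto_nhds_unique (((continuous_derivative.tendsto g).comp hg).const_mul X) ?_
  refine (Tendsto.mul (show Tendsto _ _ _ from hg) (show Tendsto _ _ _ from hm)).congr fun s => ?_
  exact (HasLogDeriv.prod h s).symm

/-- Since `ℓ` has no constant term, the equation expresses `n + 1` times the coefficient of `X ^ (n
+ 1)` through lower coefficients; the difference `f - g` then vanishes by induction. -/
theorem HasLogDeriv.unique {f g ℓ : ℝ⟦X⟧} (hf : HasLogDeriv f ℓ) (hg : HasLogDeriv g ℓ)
    (hℓ : constantCoeff ℓ = 0) (h0 : constantCoeff f = constantCoeff g) : f = g := by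
  have key : X * d⁄dX ℝ (f - g) = (f - g) * ℓ := by
    rw [HasLogDeriv] at *
    rw [map_sub, mul_sub, hf, hg, sub_mul]
  have h : ∀ n, coeff n (f - g) = 0 := by
    intro n
    induction n using Nat.strong_induction_on with
    | _ n ih =>
      rcases n with _ | n
      · rw [coeff_zero_eq_constantCoeff_apply, map_sub, h0, sub_self]
      have h1 := congrArg (coeff (n + 1)) key
      rw [coeff_succ_X_mul, coeff_derivative, coeff_mul, Finset.sum_eq_zero] at h1
      · exact (mul_eq_zero.1 h1).resolve_right (by positivity)
      · rintro ⟨a, b⟩ hab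
        rw [Finset.HasAntidiagonal.mem_antidiagonal] at hab
        simp only at hab ⊢
        rcases Nat.eq_zero_or_pos b with rfl | hb
        · rw [coeff_zero_eq_constantCoeff_apply, hℓ, mul_zero]
        · rw [ih a (by omega), zero_mul]
  exact sub_eq_zero.1 (PowerSeries.ext fun n => by rw [h n, map_zero])

/-- The logarithmic derivative of `1 - τ * X ^ d`. -/
def binomialLogDeriv (τ : ℝ) (d : ℕ) : ℝ⟦X⟧ :=
  PowerSeries.mk fun k => if d ∣ k ∧ k ≠ 0 then -(d * τ ^ (k / d)) else 0

theorem hasLogDeriv_one_sub (τ : ℝ) {d : ℕ} (hd : d ≠ 0) :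
    HasLogDeriv (1 - C τ * X ^ d) (binomialLogDeriv τ d) := by
  have hd' : 0 < d := Nat.pos_of_ne_zero hd
  have e : X * d⁄dX ℝ (1 - C τ * X ^ d) = C (-(d * τ)) * X ^ d := by
    obtain ⟨n, rfl⟩ := Nat.exists_eq_succ_of_ne_zero hd
    rw [map_sub, derivative_one, Derivation.leibniz, derivative_C, derivative_pow, derivative_X]
    simp only [smul_eq_mul, Nat.succ_eq_add_one, Nat.add_sub_cancel, map_neg, map_mul,
      map_natCast]
    ring
  rw [HasLogDeriv, e, sub_mul, one_mul]
  ext k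
  rw [map_sub, mul_assoc, coeff_C_mul, coeff_C_mul, coeff_X_pow, coeff_X_pow_mul',
    binomialLogDeriv, coeff_mk]
  by_cases hdk : d ∣ k
  · obtain ⟨n, rfl⟩ := hdk
    rcases n with _ | _ | n
    · simp [hd, hd.symm]
    · simp [hd, hd']
    · have h1 : d * (n + 1 + 1) ≠ d := by
        intro h
        have := Nat.eq_of_mul_eq_mul_left hd' (h.trans (mul_one d).symm)
        omega
      have h2 : d ≤ d * (n + 1 + 1) := Nat.le_mul_of_pos_right _ (by omega)
      have h3 : d * (n + 1 + 1) - d = d * (n + 1) := by rw [mul_add d (n + 1), mul_one,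
        Nat.add_sub_cancel]
      rw [if_neg h1, if_pos h2, h3, coeff_mk, Nat.mul_div_cancel_left _ hd',
        Nat.mul_div_cancel_left _ hd', if_pos ⟨dvd_mul_right _ _, by positivity⟩,
        if_pos ⟨dvd_mul_right _ _, by positivity⟩]
      ring
  · have h1 : k ≠ d := fun h => hdk (h ▸ dvd_rfl)
    rw [if_neg h1, if_neg fun h => hdk h.1]
    split_ifs with h2
    · rw [coeff_mk, if_neg fun h => hdk ((Nat.dvd_sub_iff_left h2 dvd_rfl).1 h.1)]
      ring
    · ring

end LogDeriv

/-! ### The two Euler products in closed form. -/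

section EulerProducts

variable (F : Type*) [Field F]

/-- The factor of index `d` of `∏_d (1 - σ X^d)^(N^*(q; 2d)) (1 - X^d)^(M^*(q; d))`. -/
def eulerFactor (σ : ℝ) (d : ℕ+) : ℝ⟦X⟧ :=
  (1 - C σ * X ^ (d : ℕ)) ^ numSelfDual F (2 * d) * (1 - C 1 * X ^ (d : ℕ)) ^ numDualPairs F d

theorem X_pow_dvd_pow_sub_one {d : ℕ} (a : ℝ⟦X⟧) (n : ℕ) :
    X ^ d ∣ (1 - a * X ^ d) ^ n - 1 := by
  have h := sub_dvd_pow_sub_pow (1 - a * X ^ d) 1 n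
  rw [one_pow] at h
  refine Dvd.dvd.trans ⟨-a, ?_⟩ h
  ring

theorem dvd_mul_sub_one {a f g : ℝ⟦X⟧} (hf : a ∣ f - 1) (hg : a ∣ g - 1) : a ∣ f * g - 1 := by
  rw [show f * g - 1 = (f - 1) * g + (g - 1) by ring]
  exact dvd_add (hf.mul_right _) hg

theorem X_pow_dvd_eulerFactor_sub_one (σ : ℝ) (d : ℕ+) :
    X ^ (d : ℕ) ∣ eulerFactor F σ d - 1 :=
  dvd_mul_sub_one (X_pow_dvd_pow_sub_one _ _) (X_pow_dvd_pow_sub_one _ _)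

/-- The product `∏_d (1 - σ X^d)^(N^*(q; 2d)) (1 - X^d)^(M^*(q; d))`. -/
def eulerProd (σ : ℝ) : ℝ⟦X⟧ := ∏' d, eulerFactor F σ d

theorem hasProd_eulerProd (σ : ℝ) : HasProd (eulerFactor F σ) (eulerProd F σ) :=
  (nearOne_of_X_pow_dvd (X_pow_dvd_eulerFactor_sub_one F σ)).multipliable.hasProd

theorem constantCoeff_eulerFactor (σ : ℝ) (d : ℕ+) : constantCoeff (eulerFactor F σ d) = 1 := by
  simp [eulerFactor]

theorem constantCoeff_eulerProd (σ : ℝ) : constantCoeff (eulerProd F σ) = 1 := by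
  have h := (hasProd_eulerProd F σ).map (constantCoeff (R := ℝ))
    (WithPiTopology.continuous_constantCoeff ℝ)
  refine h.unique ?_
  convert! hasProd_one with d
  exact constantCoeff_eulerFactor F σ d

theorem coeff_natCast_mul (n : ℕ) (f : ℝ⟦X⟧) (k : ℕ) : coeff k ((n : ℝ⟦X⟧) * f) = n * coeff k f := by
  rw [← map_natCast (C (R := ℝ)), coeff_C_mul]

theorem hasLogDeriv_eulerProd (σ : ℝ) : HasLogDeriv (eulerProd F σ)
    (PowerSeries.mk fun k => -∑ d ∈ k.divisors,
      (d * (numSelfDual F (2 * d) * σ ^ (k / d) + numDualPairs F d) : ℝ)) := by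
  refine HasLogDeriv.of_hasProd (hasProd_eulerProd F σ) ?_ fun d =>
    ((hasLogDeriv_one_sub σ d.ne_zero).pow _).mul ((hasLogDeriv_one_sub 1 d.ne_zero).pow _)
  refine (WithPiTopology.hasSum_iff_hasSum_coeff ℝ).2 fun k => ?_
  -- Only divisors of `k` contribute to the coefficient of `X ^ k`, so the sum over positive `d` is
  -- finite; `G` extends its terms by zero to all of `ℕ`.
  let G : ℕ → ℝ := fun d => if d ∈ k.divisors then
    -(d * (numSelfDual F (2 * d) * σ ^ (k / d) + numDualPairs F d) : ℝ) else 0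
  have h1 : HasSum G (∑ d ∈ k.divisors, G d) := hasSum_sum_of_ne_finset_zero fun d hd => if_neg hd
  have h2 : ∑ d ∈ k.divisors, G d = -∑ d ∈ k.divisors,
      (d * (numSelfDual F (2 * d) * σ ^ (k / d) + numDualPairs F d) : ℝ) := by
    rw [← Finset.sum_neg_distrib]
    exact Finset.sum_congr rfl fun d hd => if_pos hd
  rw [coeff_mk, ← h2]
  convert! (Function.Injective.hasSum_iff PNat.coe_injective fun d hd => if_neg fun hd' => hd
    ⟨⟨d, Nat.pos_of_mem_divisors hd'⟩, rfl⟩).2 h1 using 1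
  funext d
  simp only [Function.comp, map_add, coeff_natCast_mul, binomialLogDeriv, coeff_mk,
    Nat.mem_divisors, ne_eq, one_pow]
  split_ifs <;> ring

variable {F}

theorem HasLogDeriv.one_sub_X : HasLogDeriv (1 - C 1 * X ^ 1)
    (PowerSeries.mk fun k => if k = 0 then 0 else -1) := by
  convert! hasLogDeriv_one_sub 1 one_ne_zero using 1
  ext k
  simp only [binomialLogDeriv, coeff_mk, one_dvd, true_and]
  split_ifs <;> simp_all

variable [Fintype F]

/-- Half the sum of the two degree counts: `∑_{d ∣ k} d (N^*(q;2d) + M^*(q;d)) + e = q^k`, an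
equality of logarithmic derivatives. -/
theorem eulerProd_one_mul : eulerProd F 1 * (1 - X) ^ eNum (Fintype.card F) =
    1 - C (Fintype.card F : ℝ) * X := by
  have h1 := (hasLogDeriv_eulerProd F 1).mul (HasLogDeriv.one_sub_X.pow (eNum (Fintype.card F)))
  have h2 := hasLogDeriv_one_sub (Fintype.card F : ℝ) one_ne_zero
  rw [map_one, one_mul, pow_one] at h1
  rw [pow_one] at h2
  refine h1.unique ?_ ?_ ?_
  · convert! h2 using 1
    ext k
    rw [map_add, coeff_natCast_mul, coeff_mk, coeff_mk, binomialLogDeriv, coeff_mk]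
    rcases Nat.eq_zero_or_pos k with rfl | hk
    · simp
    · have e1 := sum_odd_quotient_mul_numSelfDual F hk.ne'
      have e2 := sum_even_quotient_mul_numSelfDual F hk.ne'
      have e3 := Finset.sum_filter_add_sum_filter_not k.divisors (fun d => Even (k / d))
        fun d => d * numSelfDual F (2 * d)
      simp only [Nat.not_even_iff_odd] at e3
      have e4 : ∑ d ∈ k.divisors, d * (numSelfDual F (2 * d) + numDualPairs F d) +
          eNum (Fintype.card F) = Fintype.card F ^ k := by
        simp only [mul_add, Finset.sum_add_distrib]
        omega
      have e5 : ((∑ d ∈ k.divisors, d * (numSelfDual F (2 * d) + numDualPairs F d) +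
          eNum (Fintype.card F) : ℕ) : ℝ) = ((Fintype.card F ^ k : ℕ) : ℝ) := congrArg _ e4
      push_cast at e5
      rw [if_neg hk.ne', if_pos ⟨one_dvd _, hk.ne'⟩, Nat.div_one, Nat.cast_one, one_mul, ← e5]
      simp only [one_pow, mul_one]
      ring
  · rw [← coeff_zero_eq_constantCoeff_apply, map_add, coeff_natCast_mul, coeff_mk, coeff_mk]
    simp
  · simp [constantCoeff_eulerProd]

/-- Half the difference of the two degree counts, in which `q^k` and `e` cancel: the sum over odd
quotients exceeds the other two by `1`. -/
theorem eulerProd_neg_one_mul : eulerProd F (-1) * (1 - X) = 1 := by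
  have h1 := (hasLogDeriv_eulerProd F (-1)).mul HasLogDeriv.one_sub_X
  rw [map_one, one_mul, pow_one] at h1
  refine h1.unique ?_ ?_ ?_
  · convert! hasLogDeriv_one using 1
    ext k
    rw [map_add, coeff_mk, coeff_mk, map_zero]
    rcases Nat.eq_zero_or_pos k with rfl | hk
    · simp
    · have e1 := sum_odd_quotient_mul_numSelfDual F hk.ne'
      have e2 := sum_even_quotient_mul_numSelfDual F hk.ne'
      have e3 := Finset.sum_filter_add_sum_filter_not k.divisors (fun d => Even (k / d))
        fun d => (d * (numSelfDual F (2 * d) * (-1) ^ (k / d)) : ℝ)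
      have e4 : ∑ d ∈ k.divisors with Even (k / d),
          (d * (numSelfDual F (2 * d) * (-1) ^ (k / d)) : ℝ) =
          ((∑ d ∈ k.divisors with Even (k / d), d * numSelfDual F (2 * d) : ℕ) : ℝ) := by
        push_cast
        refine Finset.sum_congr rfl fun d hd => ?_
        rw [(Finset.mem_filter.1 hd).2.neg_one_pow, mul_one]
      have e5 : ∑ d ∈ k.divisors with ¬ Even (k / d),
          (d * (numSelfDual F (2 * d) * (-1) ^ (k / d)) : ℝ) =
          -((∑ d ∈ k.divisors with Odd (k / d), d * numSelfDual F (2 * d) : ℕ) : ℝ) := by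
        simp only [Nat.not_even_iff_odd]
        push_cast
        rw [← Finset.sum_neg_distrib]
        refine Finset.sum_congr rfl fun d hd => ?_
        rw [(Finset.mem_filter.1 hd).2.neg_one_pow]
        ring
      rw [if_neg hk.ne']
      simp only [mul_add, Finset.sum_add_distrib]
      rw [← e3, e4, e5]
      have e6 : ((∑ d ∈ k.divisors, d * numDualPairs F d : ℕ) : ℝ) =
        ∑ d ∈ k.divisors, (d * numDualPairs F d : ℝ) := by push_cast; rfl
      rw [← e6]
      have e7 : ∑ d ∈ k.divisors with Odd (k / d), d * numSelfDual F (2 * d) =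
          ∑ d ∈ k.divisors with Even (k / d), d * numSelfDual F (2 * d) +
          ∑ d ∈ k.divisors, d * numDualPairs F d + 1 := by omega
      rw [e7]
      push_cast
      ring
  · rw [← coeff_zero_eq_constantCoeff_apply, map_add, coeff_mk, coeff_mk]
    simp
  · simp [constantCoeff_eulerProd]

end EulerProducts

end CharDegree
end

/-! ### Littlewood's identity at the variables of the theorem. -/

noncomputable section

namespace CharDegree
open YoungDiagram PowerSeries Filter Topology

section Weights

variable {q : ℕ}

theorem abs_one_div_pow_le_one (n : ℕ) : |1 / (q : ℝ) ^ n| ≤ 1 := by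
  rw [abs_of_nonneg (by positivity), ← Nat.cast_pow, one_div]
  exact Nat.cast_inv_le_one _

theorem summable_one_div_pow_add (hq : 2 ≤ q) (n : ℕ) :
    Summable fun k : ℕ => 1 / (q : ℝ) ^ (n + k) := by
  have h := (summable_geometric_of_lt_one (r := 1 / (q : ℝ)) (by positivity) (by
    rw [div_lt_one (by positivity)]
    exact_mod_cast hq)).mul_left ((1 / (q : ℝ)) ^ n)
  refine h.congr fun k => ?_
  rw [← pow_add, one_div_pow]

theorem summable_one_div_pow_pair (hq : 2 ≤ q) :
    Summable fun p : ℕ × ℕ => 1 / (q : ℝ) ^ (2 * p.1 + p.2 + 3) := by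
  have h1 := summable_one_div_pow_add hq 0
  have h2 := h1.comp_injective (i := fun k => 2 * k) fun a b (h : 2 * a = 2 * b) => by omega
  have h3 := summable_one_div_pow_add hq 3
  have h := h2.mul_of_nonneg h3 (fun _ => by simp only [Function.comp, Pi.zero_apply]; positivity)
    fun _ => by simp only [Pi.zero_apply]; positivity
  refine h.congr fun p => ?_
  simp only [Function.comp]
  rw [div_mul_div_comm, mul_one, ← pow_add]
  congr 2
  omega

/-- The indices of the linear factors `1 - x_i` and of the quadratic factors `1 - x_i x_j`, where
`(i, k)` stands for the pair `i < i + k + 1`. -/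
abbrev FactorIndex : Type := ℕ ⊕ ℕ × ℕ

/-- The coefficient of a factor. -/
def factorCoeff (q : ℕ) : FactorIndex → ℝ
  | .inl i => 1 / (q : ℝ) ^ (i + 1)
  | .inr p => 1 / (q : ℝ) ^ (2 * p.1 + p.2 + 3)

/-- The degree of a factor. -/
def factorDeg : FactorIndex → ℕ+
  | .inl _ => 1
  | .inr _ => 2

/-- The exponent of the sign of a factor. -/
def factorSign : FactorIndex → ℕ
  | .inl i => i
  | .inr p => p.2

theorem summable_factorCoeff (hq : 2 ≤ q) : Summable (factorCoeff q) := by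
  refine Summable.sum (f := factorCoeff q) ?_ ?_
  · refine (summable_one_div_pow_add hq 1).congr fun i => ?_
    rw [add_comm]
    rfl
  · exact summable_one_div_pow_pair hq

theorem abs_factorCoeff_le_one (j : FactorIndex) : |factorCoeff q j| ≤ 1 := by
  rcases j with i | p <;> exact abs_one_div_pow_le_one _

/-- The substitution attached to a factor. -/
def factorDilate (q : ℕ) (j : FactorIndex) : ℝ⟦X⟧ →+* ℝ⟦X⟧ :=
  dilate (factorCoeff q j) (factorDeg j)

theorem sign_pow_mem {ε : ℝ} (hε : ε ^ 2 = 1) (n : ℕ) : ε ^ n = 1 ∨ ε ^ n = ε := by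
  rcases Nat.even_or_odd' n with ⟨k, rfl | rfl⟩
  · left
    rw [pow_mul, hε, one_pow]
  · right
    rw [pow_succ, pow_mul, hε, one_pow, one_mul]

/-- The sign takes only the values `1` and `ε`, which gives a bound for the coefficients that is
uniform in `j`. -/
theorem nearOne_factorDilate_sign (hq : 2 ≤ q) {ε : ℝ} (hε : ε ^ 2 = 1) (f : ℝ → ℝ⟦X⟧)
    (h0 : ∀ τ, constantCoeff (f τ) = 1) :
    NearOne fun j => factorDilate q j (f (ε ^ factorSign j)) := by
  refine nearOne_dilate (summable_factorCoeff hq) abs_factorCoeff_le_one factorDeg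
    (fun _ => h0 _) fun m => ⟨max |coeff m (f 1)| |coeff m (f ε)|, fun j => ?_⟩
  rcases sign_pow_mem hε (factorSign j) with h | h <;> rw [h]
  · exact le_max_left _ _
  · exact le_max_right _ _

theorem dilate_one_sub (c : ℝ) (s : ℕ+) (τ : ℝ) (d : ℕ) :
    dilate c s (1 - C τ * X ^ d) = 1 - C (τ * c ^ d) * X ^ ((s : ℕ) * d) := by
  rw [map_sub, map_one, map_mul, map_pow, dilate_X, dilate_C, mul_pow, ← pow_mul, map_mul, map_pow,
    mul_assoc]

/-- The finite sets of factors in which only the first `n` variables occur. -/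
def factorFinset (n : ℕ) : Finset FactorIndex :=
  (Finset.range n).disjSum ((Finset.range n ×ˢ Finset.range n).filter fun p => p.1 + p.2 + 1 < n)

theorem tendsto_factorFinset : Tendsto factorFinset atTop atTop := by
  refine tendsto_atTop_finset_of_monotone ?_ ?_
  · intro m n hmn
    refine Finset.disjSum_mono (Finset.range_mono hmn) fun p hp => ?_
    simp only [Finset.mem_filter, Finset.mem_product, Finset.mem_range] at hp ⊢
    omega
  · rintro (i | p)
    · exact ⟨i + 1, Finset.inl_mem_disjSum.2 (Finset.self_mem_range_succ i)⟩
    · refine ⟨p.1 + p.2 + 2, Finset.inr_mem_disjSum.2 ?_⟩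
      simp only [Finset.mem_filter, Finset.mem_product, Finset.mem_range]
      omega

theorem prod_factorFinset (n : ℕ) (f : FactorIndex → ℝ⟦X⟧) :
    ∏ j ∈ factorFinset n, f j = ∏ j ∈ Finset.range n, (f (.inl j) *
      ∏ i ∈ Finset.range j, f (.inr (i, j - i - 1))) := by
  rw [factorFinset, Finset.prod_disjSum, Finset.prod_mul_distrib]
  congr 1
  rw [Finset.prod_sigma']
  refine Finset.prod_bij' (fun p _ => ⟨p.1 + p.2 + 1, p.1⟩) (fun p _ => (p.2, p.1 - p.2 - 1))
    ?_ ?_ ?_ ?_ ?_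
  · intro p hp
    simp only [Finset.mem_filter, Finset.mem_product, Finset.mem_range, Finset.mem_sigma] at hp ⊢
    omega
  · intro p hp
    simp only [Finset.mem_filter, Finset.mem_product, Finset.mem_range, Finset.mem_sigma] at hp ⊢
    omega
  · rintro ⟨i, k⟩ _
    simp only [Prod.mk.injEq, true_and]
    omega
  · rintro ⟨j, i⟩ hp
    simp only [Finset.mem_sigma, Finset.mem_range] at hp
    simp only [Sigma.mk.injEq, heq_eq_eq, and_true]
    omega
  · rintro ⟨i, k⟩ _
    simp only
    congr 3
    omega

/-- The variables `ε ^ i / q ^ (d * (i + 1))`. -/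
def scaledVars (q : ℕ) (ε : ℝ) (d : ℕ) (i : ℕ) : ℝ := ε ^ i * (1 / (q : ℝ) ^ (i + 1)) ^ d

theorem summable_scaledVars (hq : 2 ≤ q) {ε : ℝ} (hε : ε ^ 2 = 1) {d : ℕ} (hd : d ≠ 0) :
    Summable (scaledVars q ε d) := by
  refine Summable.of_norm_bounded (summable_one_div_pow_add hq 1) fun i => ?_
  have h1 : |ε| = 1 := by
    rw [← sq_eq_sq₀ (abs_nonneg _) zero_le_one, sq_abs, hε, one_pow]
  rw [scaledVars, norm_mul, norm_pow, norm_pow, Real.norm_eq_abs, Real.norm_eq_abs, h1, one_pow,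
    one_mul, add_comm]
  refine (pow_le_of_le_one (abs_nonneg _) (abs_one_div_pow_le_one _) hd).trans_eq ?_
  exact abs_of_nonneg (by positivity)

/-- The Littlewood identity `∑_μ ε ^ a(μ) s_μ = ∏_i (1 - x_i)⁻¹ ∏_{i<j} (1 - ε x_i x_j)⁻¹` for
`x_i = ε ^ i (X / q ^ (i + 1)) ^ d`. -/
theorem tsum_schur_mul_tprod (hq : 2 ≤ q) {ε : ℝ} (hε : ε ^ 2 = 1) {d : ℕ} (hd : d ≠ 0) :
    (∑' μ : YoungDiagram, C (ε ^ aStat μ * schur μ (scaledVars q ε d)) * X ^ (μ.card * d)) *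
      ∏' j, factorDilate q j (1 - C (ε ^ factorSign j) * X ^ d) = 1 := by
  have h0 : ∀ τ : ℝ, constantCoeff (1 - C τ * X ^ d : ℝ⟦X⟧) = 1 := fun τ => by simp [hd]
  have hP := (nearOne_factorDilate_sign hq hε (fun τ => 1 - C τ * X ^ d) h0).multipliable.hasProd
  have hP' := Tendsto.comp (show Tendsto _ _ _ from hP) tendsto_factorFinset
  have hF := tendsto_tsum_sign_mul_schurSeries (scaledVars q ε d) hd
    (summable_scaledVars hq hε hd) ε
  refine tendsto_nhds_unique (hF.mul hP') ?_
  refine tendsto_const_nhds.congr fun n => ?_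
  have hb : (C ε : ℝ⟦X⟧) ^ 2 = 1 := by rw [← map_pow, hε, map_one]
  refine (tsum_sign_mul_schurSeries_mul_prod (scaledVars q ε d) hd hb n).symm.trans ?_
  congr 1
  rw [Function.comp, prod_factorFinset]
  refine Finset.prod_congr rfl fun j _ => ?_
  congr 1
  · rw [factorDilate, dilate_one_sub]
    simp only [factorSign, factorCoeff, factorDeg, PNat.one_coe, one_mul, scaledVars]
  · refine Finset.prod_congr rfl fun i hi => ?_
    obtain ⟨k, rfl⟩ := Nat.exists_eq_add_of_lt (Finset.mem_range.1 hi)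
    rw [factorDilate, dilate_one_sub]
    simp only [factorSign, factorCoeff, factorDeg]
    rw [show i + k + 1 - i - 1 = k by omega]
    -- The exponents of `ε` from the two variables and from Littlewood's sign add up to `2 * i + k +
    -- 2`, so the sign depends on `k` alone.
    have e : ε ^ k * (1 / (q : ℝ) ^ (2 * i + k + 3)) ^ d =
        scaledVars q ε d i * (ε * scaledVars q ε d (i + k + 1)) := by
      have e1 : ε ^ i * (ε * ε ^ (i + k + 1)) = ε ^ k := by
        rw [show ε ^ i * (ε * ε ^ (i + k + 1)) = (ε ^ 2) ^ (i + 1) * ε ^ k by ring, hε, one_pow,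
          one_mul]
      rw [scaledVars, scaledVars, ← e1]
      rw [show (1 / (q : ℝ) ^ (2 * i + k + 3)) = 1 / (q : ℝ) ^ (i + 1) *
        (1 / (q : ℝ) ^ (i + k + 1 + 1)) by rw [div_mul_div_comm, one_mul, ← pow_add]; congr 2; omega]
      ring
    rw [e, map_mul, map_mul, show ((2 : ℕ+) : ℕ) = 2 from rfl]
    ring

theorem schur_const_mul (μ : YoungDiagram) (a : ℝ) (x : ℕ → ℝ) :
    schur μ (fun k => a * x k) = a ^ μ.card * schur μ x := by
  rw [schur, schur, ← tsum_mul_left]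
  refine tsum_congr fun T => ?_
  rw [tableauTerm, tableauTerm, Finset.prod_mul_distrib, Finset.prod_const, YoungDiagram.card]

theorem varsU_two_mul (q d k : ℕ) : varsU q (2 * d) k = (-1) ^ k * (1 / (q : ℝ) ^ k) ^ d := by
  have h : (q : ℝ) ^ (((2 * d : ℕ) : ℝ) / 2) = (q : ℝ) ^ d := by
    rw [Nat.cast_mul, Nat.cast_ofNat, mul_div_cancel_left₀ _ two_ne_zero, Real.rpow_natCast]
  rw [varsU, h, neg_div, neg_pow, one_div_pow, one_div_pow, ← pow_mul, ← pow_mul, mul_comm d]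

theorem varsGL_eq (q d k : ℕ) : varsGL q d k = 1 ^ k * (1 / (q : ℝ) ^ k) ^ d := by
  rw [varsGL, one_pow, one_mul, one_div_pow, pow_mul]

theorem scaledVars_eq (q d : ℕ) (ε : ℝ) : scaledVars q ε d =
    fun k => (1 / (q : ℝ)) ^ d * (ε ^ k * (1 / (q : ℝ) ^ k) ^ d) := by
  funext k
  rw [scaledVars, pow_succ, ← one_div_mul_one_div, mul_pow]
  ring

/-- The prefactor `q ^ (-d|μ|)` is absorbed into the variables, `s_μ` being homogeneous of degree
`|μ|`. -/
theorem deltaU_two_mul (q d : ℕ) (μ : YoungDiagram) :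
    deltaU q μ (2 * d) = (-1) ^ aStat μ * schur μ (scaledVars q (-1) d) := by
  have h : (q : ℝ) ^ (((2 * d : ℕ) : ℝ) * (μ.card : ℝ) / 2) = (q : ℝ) ^ (d * μ.card) := by
    rw [← Real.rpow_natCast]
    congr 1
    push_cast
    ring
  rw [scaledVars_eq, schur_const_mul, deltaU, h, show varsU q (2 * d) = _ from
    funext (varsU_two_mul q d), ← pow_mul, one_div_pow]
  ring

theorem deltaGL_eq (q d : ℕ) (μ : YoungDiagram) :
    deltaGL q μ d = 1 ^ aStat μ * schur μ (scaledVars q 1 d) := by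
  rw [scaledVars_eq, schur_const_mul, deltaGL, show varsGL q d = _ from
    funext (varsGL_eq q d), ← pow_mul, one_div_pow, one_pow, one_mul]

theorem summable_varsU (hq : 2 ≤ q) (d : ℕ+) : Summable (varsU q (2 * d)) := by
  have h := (summable_scaledVars hq (ε := -1) (by norm_num) d.ne_zero).mul_left ((q : ℝ) ^ (d : ℕ))
  refine h.congr fun k => ?_
  have : (q : ℝ) ≠ 0 := by positivity
  rw [scaledVars_eq, varsU_two_mul, ← mul_assoc, ← mul_pow, mul_one_div_cancel this, one_pow, one_mul]

theorem summable_varsGL (hq : 2 ≤ q) (d : ℕ+) : Summable (varsGL q d) := by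
  have h := (summable_scaledVars hq (ε := 1) (by norm_num) d.ne_zero).mul_left ((q : ℝ) ^ (d : ℕ))
  refine h.congr fun k => ?_
  have : (q : ℝ) ≠ 0 := by positivity
  rw [scaledVars_eq, varsGL_eq, ← mul_assoc, ← mul_pow, mul_one_div_cancel this, one_pow, one_mul]

theorem summable_C_mul_X_pow_card (f : YoungDiagram → ℝ) {d : ℕ} (hd : d ≠ 0) :
    Summable fun μ : YoungDiagram => (C (f μ) * X ^ (μ.card * d) : ℝ⟦X⟧) := by
  simpa using summable_mul_X_pow_card hd (fun _ => 1) fun μ => C (f μ)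

/-- The product `∏_i (1 - x_i) ∏_{i<j} (1 - ε x_i x_j)` for `x_i = ε ^ i (X / q ^ (i + 1)) ^ d`. -/
def factorProd (q : ℕ) (ε : ℝ) (d : ℕ) : ℝ⟦X⟧ :=
  ∏' j, factorDilate q j (1 - C (ε ^ factorSign j) * X ^ d)

theorem hasProd_factorProd (hq : 2 ≤ q) {ε : ℝ} (hε : ε ^ 2 = 1) {d : ℕ} (hd : d ≠ 0) :
    HasProd (fun j => factorDilate q j (1 - C (ε ^ factorSign j) * X ^ d)) (factorProd q ε d) :=
  (nearOne_factorDilate_sign hq hε (fun τ => 1 - C τ * X ^ d)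
    fun τ => by simp [hd]).multipliable.hasProd

theorem tsum_termU_mul (hq : 2 ≤ q) (d : ℕ+) :
    (∑' μ, termU q d μ) * factorProd q (-1) d = 1 := by
  rw [← tsum_schur_mul_tprod hq (ε := -1) (by norm_num) d.ne_zero, factorProd]
  simp only [termU, deltaU_two_mul]

theorem tsum_termGL_mul (hq : 2 ≤ q) (d : ℕ+) :
    (∑' μ, termGL q d μ) * factorProd q 1 d = 1 := by
  rw [← tsum_schur_mul_tprod hq (ε := 1) (by norm_num) d.ne_zero, factorProd]
  simp only [termGL, deltaGL_eq]

/-- Congruence to `1` modulo `X ^ d` passes to finite products and to coefficientwise limits. -/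
theorem X_pow_dvd_sub_one_of_hasProd {ι : Type*} {f : ι → ℝ⟦X⟧} {g : ℝ⟦X⟧} {d : ℕ}
    (hg : HasProd f g) (h : ∀ i, X ^ d ∣ f i - 1) : X ^ d ∣ g - 1 := by
  refine X_pow_dvd_iff.2 fun m hm => ?_
  have ht : Tendsto (fun s => ∏ i ∈ s, f i) (atTop : Filter (Finset ι)) (𝓝 g) := hg
  have h1 := ((WithPiTopology.continuous_coeff ℝ m).tendsto (g - 1)).comp (ht.sub_const 1)
  refine tendsto_nhds_unique h1 (tendsto_const_nhds.congr fun s => ?_)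
  have h2 : X ^ d ∣ ∏ i ∈ s, f i - 1 := by
    classical
    induction s using Finset.induction_on with
    | empty => rw [Finset.prod_empty, sub_self]; exact dvd_zero _
    | insert a s ha ih =>
      rw [Finset.prod_insert ha]
      exact dvd_mul_sub_one (h a) ih
  exact (X_pow_dvd_iff.1 h2 m hm).symm

theorem X_pow_dvd_factorProd_sub_one (hq : 2 ≤ q) {ε : ℝ} (hε : ε ^ 2 = 1) {d : ℕ} (hd : d ≠ 0) :
    X ^ d ∣ factorProd q ε d - 1 := by
  refine X_pow_dvd_sub_one_of_hasProd (hasProd_factorProd hq hε hd) fun j => ?_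
  rw [factorDilate, dilate_one_sub, sub_sub_cancel_left, dvd_neg]
  exact (pow_dvd_pow X (Nat.le_mul_of_pos_left d (factorDeg j).pos)).mul_left _

theorem dvd_sub_one_of_mul_eq_one {a f g : ℝ⟦X⟧} (hg : a ∣ g - 1) (h : f * g = 1) : a ∣ f - 1 := by
  rw [show f - 1 = -f * (g - 1) by linear_combination h]
  exact hg.mul_left _

theorem dvd_pow_sub_one {a f : ℝ⟦X⟧} (hf : a ∣ f - 1) (n : ℕ) : a ∣ f ^ n - 1 := by
  have h := sub_dvd_pow_sub_pow f 1 n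
  rw [one_pow] at h
  exact hf.trans h

end Weights

end CharDegree
end

/-! ### Telescoping of the Euler products. -/

noncomputable section

namespace CharDegree
open PowerSeries

section Telescoping

variable {F : Type*} [Field F] {q : ℕ}

theorem neg_one_sq_real : (-1 : ℝ) ^ 2 = 1 := by norm_num

theorem nearOne_factorDilate_eulerProd (hq : 2 ≤ q) :
    NearOne fun j => factorDilate q j (eulerProd F ((-1) ^ factorSign j)) :=
  nearOne_factorDilate_sign hq neg_one_sq_real (fun τ => eulerProd F τ) (constantCoeff_eulerProd F)

variable [Fintype F]

theorem dilate_one_sub_X (c : ℝ) (s : ℕ+) : dilate c s (1 - X) = 1 - C c * X ^ (s : ℕ) := by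
  rw [map_sub, map_one, dilate_X]

/-- The factor `q` in `1 - q X` cancels one power of `q` in the dilation. This shift from `n + 1` to
`n` drives the telescoping. -/
theorem dilate_eulerProd_one_mul (hF : Fintype.card F = q) (hq : 2 ≤ q) (n : ℕ) (s : ℕ+) :
    dilate (1 / (q : ℝ) ^ (n + 1)) s (eulerProd F 1) *
      dilate (1 / (q : ℝ) ^ (n + 1)) s (1 - X) ^ eNum q = dilate (1 / (q : ℝ) ^ n) s (1 - X) := by
  have hq0 : (q : ℝ) ≠ 0 := by positivity
  have h := congrArg (dilate (1 / (q : ℝ) ^ (n + 1)) s) (eulerProd_one_mul (F := F))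
  rw [hF, map_mul, map_pow] at h
  rw [h, dilate_one_sub_X, map_sub, map_one, map_mul, dilate_C, dilate_X, ← mul_assoc, ← map_mul,
    pow_succ, mul_one_div, div_mul_cancel_right₀ hq0, one_div]

theorem dilate_eulerProd_neg_one_mul (c : ℝ) (s : ℕ+) :
    dilate c s (eulerProd F (-1)) * dilate c s (1 - X) = 1 := by
  rw [← map_mul, eulerProd_neg_one_mul, map_one]

theorem nearOne_dilate_one_div_pow (hq : 2 ≤ q) (n : ℕ) (s : ℕ+) {f : ℝ⟦X⟧}
    (h0 : constantCoeff f = 1) : NearOne fun k : ℕ => dilate (1 / (q : ℝ) ^ (n + k)) s f :=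
  nearOne_dilate_const (summable_one_div_pow_add hq n) (fun _ => abs_one_div_pow_le_one _)
    (fun _ => s) h0

theorem constantCoeff_one_sub_X : constantCoeff (1 - X : ℝ⟦X⟧) = 1 := by simp

theorem nearOne_dilate_two_mul (hq : 2 ≤ q) (n : ℕ) (s : ℕ+) {f : ℝ⟦X⟧}
    (h0 : constantCoeff f = 1) : NearOne fun k : ℕ => dilate (1 / (q : ℝ) ^ (n + 2 * k)) s f :=
  (nearOne_dilate_one_div_pow hq n s h0).comp_injective
    (e := fun k => 2 * k) fun a b (h : 2 * a = 2 * b) => by omega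

/-- Even `k` contribute, together with the `eNum q`-th powers, the factors `1 - v/q^(n+2m)`; odd `k`
contribute the inverses of `1 - v/q^(n+2+2m)`, where `v = X ^ s`. All cancels except the factor with
`m = 0`. -/
theorem tprod_dilate_eulerProd_mul (hF : Fintype.card F = q) (hq : 2 ≤ q) (n : ℕ) (s : ℕ+) :
    (∏' k : ℕ, dilate (1 / (q : ℝ) ^ (n + 1 + k)) s (eulerProd F ((-1) ^ k))) *
      ∏' m : ℕ, dilate (1 / (q : ℝ) ^ (n + 1 + 2 * m)) s (1 - X) ^ eNum q =
        dilate (1 / (q : ℝ) ^ n) s (1 - X) := by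
  have h1 := (nearOne_dilate_two_mul hq (n + 1) s (constantCoeff_eulerProd F 1)).multipliable
  have h2 := (nearOne_dilate_two_mul hq (n + 2) s (constantCoeff_eulerProd F (-1))).multipliable
  have h3 := (nearOne_dilate_two_mul hq (n + 1) s constantCoeff_one_sub_X).multipliable
  have h4 := (nearOne_dilate_two_mul hq (n + 2) s constantCoeff_one_sub_X).multipliable
  have e1 : ∏' k : ℕ, dilate (1 / (q : ℝ) ^ (n + 1 + k)) s (eulerProd F ((-1) ^ k)) =
      (∏' k : ℕ, dilate (1 / (q : ℝ) ^ (n + 1 + 2 * k)) s (eulerProd F 1)) *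
        ∏' k : ℕ, dilate (1 / (q : ℝ) ^ (n + 2 + 2 * k)) s (eulerProd F (-1)) := by
    rw [← tprod_even_mul_odd]
    · congr 1
      · refine tprod_congr fun k => ?_
        rw [pow_mul, neg_one_sq, one_pow]
      · refine tprod_congr fun k => ?_
        rw [pow_succ, pow_mul, neg_one_sq, one_pow, one_mul,
          show n + 1 + (2 * k + 1) = n + 2 + 2 * k by omega]
    · refine h1.congr fun k => ?_
      rw [pow_mul, neg_one_sq, one_pow]
    · refine h2.congr fun k => ?_
      rw [pow_succ, pow_mul, neg_one_sq, one_pow, one_mul,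
        show n + 1 + (2 * k + 1) = n + 2 + 2 * k by omega]
  have e2 : (∏' k : ℕ, dilate (1 / (q : ℝ) ^ (n + 1 + 2 * k)) s (eulerProd F 1)) *
      ∏' m : ℕ, dilate (1 / (q : ℝ) ^ (n + 1 + 2 * m)) s (1 - X) ^ eNum q =
        ∏' m : ℕ, dilate (1 / (q : ℝ) ^ (n + 2 * m)) s (1 - X) := by
    rw [← h1.tprod_mul (h3.pow _)]
    refine tprod_congr fun m => ?_
    have h := dilate_eulerProd_one_mul (F := F) hF hq (n + 2 * m) s
    rwa [show n + 2 * m + 1 = n + 1 + 2 * m by omega] at h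
  have e3 : ∏' m : ℕ, dilate (1 / (q : ℝ) ^ (n + 2 * m)) s (1 - X) =
      dilate (1 / (q : ℝ) ^ n) s (1 - X) *
        ∏' m : ℕ, dilate (1 / (q : ℝ) ^ (n + 2 + 2 * m)) s (1 - X) := by
    have h5 : Multipliable fun m : ℕ => dilate (1 / (q : ℝ) ^ (n + 2 * (m + 1))) s (1 - X) :=
      h4.congr fun m => by rw [show n + 2 * (m + 1) = n + 2 + 2 * m by ring]
    refine (tprod_eq_zero_mul' (f := fun m : ℕ => dilate (1 / (q : ℝ) ^ (n + 2 * m)) s (1 - X))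
      h5).trans ?_
    refine congrArg₂ _ rfl (tprod_congr fun m => ?_)
    rw [show n + 2 * (m + 1) = n + 2 + 2 * m by ring]
  have e4 : (∏' k : ℕ, dilate (1 / (q : ℝ) ^ (n + 2 + 2 * k)) s (eulerProd F (-1))) *
      ∏' m : ℕ, dilate (1 / (q : ℝ) ^ (n + 2 + 2 * m)) s (1 - X) = 1 := by
    rw [← h2.tprod_mul h4]
    simp only [dilate_eulerProd_neg_one_mul, tprod_one]
  rw [e1, mul_right_comm, e2, e3, mul_assoc, mul_comm (∏' m : ℕ, _), e4, mul_one]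

theorem multipliable_pair_pow (hq : 2 ≤ q) : Multipliable fun p : ℕ × ℕ =>
    dilate (1 / (q : ℝ) ^ (2 * p.1 + 2 + 1 + 2 * p.2)) 2 (1 - X) ^ eNum q := by
  have h : NearOne fun p : ℕ × ℕ => dilate (1 / (q : ℝ) ^ (2 * p.1 + p.2 + 3)) 2 (1 - X) :=
    nearOne_dilate_const (summable_one_div_pow_pair hq) (fun _ => abs_one_div_pow_le_one _)
      (fun _ => 2) constantCoeff_one_sub_X
  have h' := (h.comp_injective (e := fun p : ℕ × ℕ => (p.1, 2 * p.2)) fun a b hab => by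
    simp only [Prod.mk.injEq] at hab
    exact Prod.ext hab.1 (by omega)).multipliable.pow (eNum q)
  refine h'.congr fun p => ?_
  rw [show 2 * p.1 + 2 + 1 + 2 * p.2 = 2 * p.1 + 2 * p.2 + 3 by ring]

theorem factorDilate_inl (i : ℕ) : factorDilate q (.inl i) = dilate (1 / (q : ℝ) ^ (i + 1)) 1 := rfl

theorem factorDilate_inr (p : ℕ × ℕ) :
    factorDilate q (.inr p) = dilate (1 / (q : ℝ) ^ (2 * p.1 + p.2 + 3)) 2 := rfl

/-- The product over the linear factors. -/
theorem tprod_factorDilate_inl_mul (hF : Fintype.card F = q) (hq : 2 ≤ q) :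
    (∏' i : ℕ, factorDilate q (.inl i) (eulerProd F ((-1) ^ i))) *
      ∏' m : ℕ, dilate (1 / (q : ℝ) ^ (1 + 2 * m)) 1 (1 - X) ^ eNum q = 1 - X := by
  have h := tprod_dilate_eulerProd_mul (F := F) hF hq 0 1
  rw [dilate_one_sub_X, pow_zero, div_one, map_one, one_mul, PNat.one_coe, pow_one] at h
  simp only [zero_add] at h
  refine Eq.trans (congrArg₂ _ (tprod_congr fun i => ?_) rfl) h
  rw [add_comm 1 i, factorDilate_inl]

theorem tprod_factorDilate_row_mul (hF : Fintype.card F = q) (hq : 2 ≤ q) (i : ℕ) :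
    (∏' k : ℕ, factorDilate q (.inr (i, k)) (eulerProd F ((-1) ^ k))) *
      ∏' l : ℕ, dilate (1 / (q : ℝ) ^ (2 * i + 2 + 1 + 2 * l)) 2 (1 - X) ^ eNum q =
        dilate (1 / (q : ℝ) ^ (2 + 2 * i)) 2 (1 - X) := by
  rw [add_comm 2 (2 * i)]
  refine Eq.trans (congrArg₂ _ (tprod_congr fun k => ?_) rfl)
    (tprod_dilate_eulerProd_mul (F := F) hF hq (2 * i + 2) 2)
  rw [show 2 * i + 2 + 1 + k = 2 * i + k + 3 by ring, factorDilate_inr]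

/-- The product over the quadratic factors. -/
theorem tprod_factorDilate_inr_mul (hF : Fintype.card F = q) (hq : 2 ≤ q) :
    (∏' p : ℕ × ℕ, factorDilate q (.inr p) (eulerProd F ((-1) ^ p.2))) *
      ∏' p : ℕ × ℕ, dilate (1 / (q : ℝ) ^ (2 * p.1 + 2 + 1 + 2 * p.2)) 2 (1 - X) ^ eNum q =
      ∏' i : ℕ, dilate (1 / (q : ℝ) ^ (2 + 2 * i)) 2 (1 - X) := by
  have hr : NearOne fun p : ℕ × ℕ => factorDilate q (.inr p) (eulerProd F ((-1) ^ p.2)) :=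
    (nearOne_factorDilate_eulerProd (F := F) hq).comp_injective Sum.inr_injective
  have hrow : ∀ i, Multipliable fun k => factorDilate q (.inr (i, k)) (eulerProd F ((-1) ^ k)) :=
    fun i => (hr.comp_injective (e := fun k => (i, k))
      fun a b hab => (Prod.ext_iff.1 hab).2).multipliable
  have hrow' : ∀ i : ℕ, Multipliable fun l : ℕ =>
      dilate (1 / (q : ℝ) ^ (2 * i + 2 + 1 + 2 * l)) 2 (1 - X) ^ eNum q := fun i =>
    (nearOne_dilate_two_mul hq _ 2 constantCoeff_one_sub_X).multipliable.pow _
  have hm := hr.multipliable.hasProd.prod_fiberwise fun i => (hrow i).hasProd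
  have hm' := (multipliable_pair_pow hq).hasProd.prod_fiberwise fun i => (hrow' i).hasProd
  rw [← hm.tprod_eq, ← hm'.tprod_eq, ← hm.multipliable.tprod_mul hm'.multipliable]
  exact tprod_congr fun i => tprod_factorDilate_row_mul hF hq i

/-- The product over all factors of the Euler products, times the numerators on the right. -/
theorem tprod_factorDilate_eulerProd_mul (hF : Fintype.card F = q) (hq : 2 ≤ q) :
    (∏' j, factorDilate q j (eulerProd F ((-1) ^ factorSign j))) *
      (∏' m : ℕ, dilate (1 / (q : ℝ) ^ (1 + 2 * m)) 1 (1 - X) ^ eNum q) *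
      (∏' p : ℕ × ℕ, dilate (1 / (q : ℝ) ^ (2 * p.1 + 2 + 1 + 2 * p.2)) 2 (1 - X) ^ eNum q) =
    (1 - X) * ∏' i : ℕ, dilate (1 / (q : ℝ) ^ (2 + 2 * i)) 2 (1 - X) := by
  have h := nearOne_factorDilate_eulerProd (F := F) hq
  have hl := (h.comp_injective Sum.inl_injective).multipliable
  have hr := (h.comp_injective Sum.inr_injective).multipliable
  refine Eq.trans ?_ (congrArg₂ (· * ·) (tprod_factorDilate_inl_mul (F := F) hF hq)
    (tprod_factorDilate_inr_mul (F := F) hF hq))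
  refine Eq.trans (congrArg (· * _ * _) (Multipliable.tprod_sum hl hr)) ?_
  exact (mul_assoc _ _ _).trans (mul_mul_mul_comm _ _ _ _)

end Telescoping

/-! ### The left side as the inverse of a product of Euler products. -/

section LeftSide

variable {F : Type*} [Field F] {q : ℕ}

theorem multipliable_factorU (hq : 2 ≤ q) : Multipliable (factorU F q) :=
  (nearOne_of_X_pow_dvd fun d => dvd_pow_sub_one (dvd_sub_one_of_mul_eq_one
    (X_pow_dvd_factorProd_sub_one hq neg_one_sq_real d.ne_zero) (tsum_termU_mul hq d)) _).multipliable

theorem multipliable_factorGL (hq : 2 ≤ q) : Multipliable (factorGL F q) :=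
  (nearOne_of_X_pow_dvd fun d => dvd_pow_sub_one (dvd_sub_one_of_mul_eq_one
    (X_pow_dvd_factorProd_sub_one hq (one_pow 2) d.ne_zero) (tsum_termGL_mul hq d)) _).multipliable

/-- At fixed `d`, Littlewood's products for `ε = -1` and `ε = 1` have the same dilations and differ
only in the signs, so their powers combine factor by factor into dilated Euler factors. -/
theorem factorU_mul_factorGL_mul (hq : 2 ≤ q) (d : ℕ+) :
    factorU F q d * factorGL F q d *
      ∏' j, factorDilate q j (eulerFactor F ((-1) ^ factorSign j) d) = 1 := by
  have h1 := (hasProd_factorProd hq neg_one_sq_real d.ne_zero).pow (numSelfDual F (2 * d))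
  have h2 := (hasProd_factorProd hq (one_pow 2) d.ne_zero).pow (numDualPairs F d)
  have e : ∏' j, factorDilate q j (eulerFactor F ((-1) ^ factorSign j) d) =
      factorProd q (-1) d ^ numSelfDual F (2 * d) * factorProd q 1 d ^ numDualPairs F d := by
    rw [← (h1.mul h2).tprod_eq]
    refine tprod_congr fun j => ?_
    rw [eulerFactor, map_mul, map_pow (factorDilate q j), map_pow (factorDilate q j), one_pow]
  rw [e, factorU, factorGL, mul_mul_mul_comm, ← mul_pow, ← mul_pow, tsum_termU_mul hq,
    tsum_termGL_mul hq, one_pow, one_pow, one_mul]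

theorem tprod_factorU_mul_tprod_factorGL_mul [Fintype F] (hq : 2 ≤ q) :
    (∏' d, factorU F q d) * (∏' d, factorGL F q d) *
      ∏' j, factorDilate q j (eulerProd F ((-1) ^ factorSign j)) = 1 := by
  have hd : ∀ d : ℕ+, NearOne fun j => factorDilate q j (eulerFactor F ((-1) ^ factorSign j) d) :=
    fun d => nearOne_factorDilate_sign hq neg_one_sq_real (fun τ => eulerFactor F τ d)
      fun τ => constantCoeff_eulerFactor F τ d
  have hdvd : ∀ (d : ℕ+) (j : FactorIndex),
      X ^ (d : ℕ) ∣ factorDilate q j (eulerFactor F ((-1) ^ factorSign j) d) - 1 := by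
    intro d j
    obtain ⟨g, hg⟩ := X_pow_dvd_eulerFactor_sub_one F ((-1) ^ factorSign j) d
    rw [← map_one (factorDilate q j), ← map_sub, hg, map_mul, map_pow, factorDilate, dilate_X]
    exact (pow_dvd_pow_of_dvd ((dvd_pow_self X (PNat.ne_zero _)).mul_left _) _).mul_right _
  have hall := (nearOne_uncurry hd hdvd).multipliable
  have hj : ∀ j, HasProd (fun d => factorDilate q j (eulerFactor F ((-1) ^ factorSign j) d))
      (factorDilate q j (eulerProd F ((-1) ^ factorSign j))) := fun j =>
    (hasProd_eulerProd F _).map (factorDilate q j) (continuous_dilate _ _)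
  have hrow := hall.hasProd.prod_fiberwise fun d => (hd d).multipliable.hasProd
  -- The exchange of the products over `d` and `j` is justified by multipliability over the pairs
  -- `(d, j)`; continuity of the dilation carries it inside the Euler product.
  have e : ∏' j, factorDilate q j (eulerProd F ((-1) ^ factorSign j)) =
      ∏' d, ∏' j, factorDilate q j (eulerFactor F ((-1) ^ factorSign j) d) := by
    rw [← hall.tprod_comm' (fun d => (hd d).multipliable) fun j => (hj j).multipliable]
    exact tprod_congr fun j => (hj j).tprod_eq.symm
  have hU := multipliable_factorU (F := F) hq
  have hGL := multipliable_factorGL (F := F) hq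
  rw [e, ← hU.tprod_mul hGL, ← (hU.mul hGL).tprod_mul hrow.multipliable]
  simp only [factorU_mul_factorGL_mul hq, tprod_one]

end LeftSide

/-! ### The products on the right in terms of dilations. -/

section RightSide

variable {q : ℕ}

/-- The inverse of `1 - u^2/q^(2i)` is written as a dilated geometric series, so that the criterion
for dilations also gives convergence of the denominators. -/
theorem factorSingle_succPNat (m : ℕ) : factorSingle q m.succPNat =
    dilate (1 / (q : ℝ) ^ (1 + 2 * m)) 1 (1 - X) ^ eNum q *
      dilate (1 / (q : ℝ) ^ (2 + 2 * m)) 2 (PowerSeries.mk 1) := by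
  have h : dilate (1 / (q : ℝ) ^ (2 + 2 * m)) 2 (PowerSeries.mk 1) *
      dilate (1 / (q : ℝ) ^ (2 + 2 * m)) 2 (1 - X) = 1 := by
    rw [← map_mul, mk_one_mul_one_sub_eq_one, map_one]
  rw [dilate_one_sub_X] at h
  rw [factorSingle, dilate_one_sub_X, PNat.one_coe, pow_one, Nat.succPNat_coe, Nat.succ_eq_add_one,
    show 2 * (m + 1) - 1 = 1 + 2 * m by omega, show 2 * (m + 1) = 2 + 2 * m by ring]
  congr 1
  refine (PowerSeries.inv_eq_iff_mul_eq_one ?_).2 ?_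
  · simp
  · exact h

theorem constantCoeff_mk_one : constantCoeff (PowerSeries.mk 1 : ℝ⟦X⟧) = 1 := by
  rw [← coeff_zero_eq_constantCoeff_apply, coeff_mk, Pi.one_apply]

theorem hasProd_factorSingle (hq : 2 ≤ q) : HasProd (factorSingle q)
    ((∏' m : ℕ, dilate (1 / (q : ℝ) ^ (1 + 2 * m)) 1 (1 - X) ^ eNum q) *
      ∏' m : ℕ, dilate (1 / (q : ℝ) ^ (2 + 2 * m)) 2 (PowerSeries.mk 1)) := by
  have h1 := (nearOne_dilate_two_mul hq 1 1 constantCoeff_one_sub_X).multipliable.pow (eNum q)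
  have h2 := (nearOne_dilate_two_mul hq 2 2 constantCoeff_mk_one).multipliable
  rw [← Equiv.pnatEquivNat.symm.hasProd_iff]
  convert! h1.hasProd.mul h2.hasProd using 1
  exact funext factorSingle_succPNat

theorem tprod_dilate_mk_one_mul (hq : 2 ≤ q) :
    (∏' m : ℕ, dilate (1 / (q : ℝ) ^ (2 + 2 * m)) 2 (PowerSeries.mk 1)) *
      ∏' m : ℕ, dilate (1 / (q : ℝ) ^ (2 + 2 * m)) 2 (1 - X) = 1 := by
  have h1 := (nearOne_dilate_two_mul hq 2 2 constantCoeff_mk_one).multipliable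
  have h2 := (nearOne_dilate_two_mul hq 2 2 constantCoeff_one_sub_X).multipliable
  rw [← h1.tprod_mul h2]
  simp only [← map_mul, mk_one_mul_one_sub_eq_one, map_one, tprod_one]

/-- The odd pairs `i < j` in terms of `i` and `(j - i - 1) / 2`. -/
def oddPairEquiv : ℕ × ℕ ≃ OddPair where
  toFun p := ⟨(p.1.succPNat, (p.1 + 2 * p.2 + 1).succPNat), by
    rw [← PNat.coe_lt_coe]
    simp only [Nat.succPNat_coe, Nat.succ_eq_add_one]
    exact ⟨by omega, ⟨p.1 + p.2 + 1, by omega⟩⟩⟩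
  invFun p := (p.1.1.natPred, (p.1.2.natPred - p.1.1.natPred - 1) / 2)
  left_inv p := by
    simp only [Nat.natPred_succPNat]
    ext <;> simp only
    omega
  right_inv p := by
    obtain ⟨⟨i, j⟩, h1, h2⟩ := p
    obtain ⟨i, rfl⟩ : ∃ k : ℕ, i = k.succPNat := ⟨_, (PNat.succPNat_natPred i).symm⟩
    obtain ⟨j, rfl⟩ : ∃ k : ℕ, j = k.succPNat := ⟨_, (PNat.succPNat_natPred j).symm⟩
    rw [← PNat.coe_lt_coe] at h1
    simp only [Nat.succPNat_coe, Nat.succ_eq_add_one] at h1 h2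
    obtain ⟨m, hm⟩ := h2
    refine Subtype.ext (Prod.ext ?_ ?_)
    · simp only [Nat.natPred_succPNat]
    · simp only [Nat.natPred_succPNat]
      congr 1
      omega

theorem hasProd_factorPair (hq : 2 ≤ q) : HasProd (factorPair q)
    (∏' p : ℕ × ℕ, dilate (1 / (q : ℝ) ^ (2 * p.1 + 2 + 1 + 2 * p.2)) 2 (1 - X) ^ eNum q) := by
  rw [← oddPairEquiv.hasProd_iff]
  convert! (multipliable_pair_pow hq).hasProd using 1
  funext p
  rw [Function.comp, factorPair, dilate_one_sub_X]
  simp only [oddPairEquiv, Equiv.coe_fn_mk, Nat.succPNat_coe, Nat.succ_eq_add_one]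
  rw [show p.1 + 1 + (p.1 + 2 * p.2 + 1 + 1) = 2 * p.1 + 2 + 1 + 2 * p.2 by ring]
  rfl

end RightSide

end CharDegree

end

/-- The identity of power series, together with the convergence of every infinite sum and product
that occurs in it. -/
theorem proposition4p1 {F : Type*} [Field F] [Fintype F] (q : ℕ) (hq : Fintype.card F = q) :
    -- the Schur functions converge absolutely at the values of the variables in question
    (∀ (d : ℕ+) (μ : YoungDiagram),
      Summable (CharDegree.tableauTerm μ (CharDegree.varsU q (2 * d))) ∧
      Summable (CharDegree.tableauTerm μ (CharDegree.varsGL q d))) ∧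
    -- the sums over all partitions converge
    (∀ d : ℕ+, Summable (CharDegree.termU q d) ∧ Summable (CharDegree.termGL q d)) ∧
    -- the infinite products converge
    Multipliable (CharDegree.factorU F q) ∧
    Multipliable (CharDegree.factorGL F q) ∧
    Multipliable (CharDegree.factorSingle q) ∧
    Multipliable (CharDegree.factorPair q) ∧
    -- the identity
    (∏' d : ℕ+, CharDegree.factorU F q d) * (∏' d : ℕ+, CharDegree.factorGL F q d) =
      (1 - PowerSeries.X : PowerSeries ℝ)⁻¹ * (∏' i : ℕ+, CharDegree.factorSingle q i) *
        ∏' p : CharDegree.OddPair, CharDegree.factorPair q p := by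
  have hq2 : 2 ≤ q := hq ▸ Fintype.one_lt_card
  refine ⟨fun d μ => ⟨CharDegree.summable_tableauTerm μ (CharDegree.summable_varsU hq2 d),
    CharDegree.summable_tableauTerm μ (CharDegree.summable_varsGL hq2 d)⟩,
    fun d => ⟨CharDegree.summable_C_mul_X_pow_card _ d.ne_zero,
      CharDegree.summable_C_mul_X_pow_card _ d.ne_zero⟩,
    CharDegree.multipliable_factorU hq2, CharDegree.multipliable_factorGL hq2,
    (CharDegree.hasProd_factorSingle hq2).multipliable,
    (CharDegree.hasProd_factorPair hq2).multipliable, ?_⟩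
  rw [(CharDegree.hasProd_factorSingle hq2).tprod_eq, (CharDegree.hasProd_factorPair hq2).tprod_eq]
  have h1 := CharDegree.tprod_factorU_mul_tprod_factorGL_mul (F := F) hq2
  have h2 := CharDegree.tprod_factorDilate_eulerProd_mul (F := F) hq hq2
  have h3 := CharDegree.tprod_dilate_mk_one_mul hq2
  have h4 : (1 - PowerSeries.X : PowerSeries ℝ)⁻¹ * (1 - PowerSeries.X) = 1 :=
    PowerSeries.inv_mul_cancel _ (by simp)
  generalize (∏' d : ℕ+, CharDegree.factorU F q d) * ∏' d : ℕ+, CharDegree.factorGL F q d = L at *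
  generalize (∏' j, CharDegree.factorDilate q j
    (CharDegree.eulerProd F ((-1) ^ CharDegree.factorSign j))) = D at *
  generalize (∏' m : ℕ, CharDegree.dilate (1 / (q : ℝ) ^ (1 + 2 * m)) 1 (1 - PowerSeries.X) ^
    CharDegree.eNum q) = A at *
  generalize (∏' p : ℕ × ℕ, CharDegree.dilate (1 / (q : ℝ) ^ (2 * p.1 + 2 + 1 + 2 * p.2)) 2
    (1 - PowerSeries.X) ^ CharDegree.eNum q) = B at *
  generalize (∏' m : ℕ, CharDegree.dilate (1 / (q : ℝ) ^ (2 + 2 * m)) 2 (PowerSeries.mk 1)) = V at *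
  generalize (∏' m : ℕ, CharDegree.dilate (1 / (q : ℝ) ^ (2 + 2 * m)) 2 (1 - PowerSeries.X)) = W at *
  generalize (1 - PowerSeries.X : PowerSeries ℝ)⁻¹ = I at *
  -- The relations are `L D = 1`, `D A B = (1 - X) W`, `V W = 1` and `I (1 - X) = 1`; eliminating
  -- `D` and `W` gives `L = I A V B`.
  linear_combination (I * A * V * B) * h1 - (L * I * V) * h2 - L * V * W * h4 - L * h3
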